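/- Let $\alpha\in\mathbb{R}$ with $\alpha\ge 1$ and let $\ell\in\{0,1,\dots,\lfloor\alpha-\tfrac12\rfloor\}$. Let \[ H_0(\gamma)=(\cos^2\pi\gamma)^{\alpha}\sum_{k=0}^{\ell}\binom{\alpha+\ell}{k}(\sin^2\pi\gamma)^k(\cos^2\pi\gamma)^{\ell-k},\qquad \binom{a}{k}=\frac{\Gamma(a+1)}{\Gamma(k+1)\Gamma(a-k+1)}, \] and, for $m\in\mathbb{N}_0$, $\widehat\varphi_m(\gamma)=\chi_{[-2^{m-1},2^{m-1}]}(\gamma)\prod_{j=1}^m H_0(2^{-j}\gamma)$. There is a unique $\varphi\in L^2(\mathbb{R})$ whose Fourier transform (normalized as $\widehat\varphi(\gamma)=\int\varphi(t)e^{-2\pi i t\gamma}\,dt$) is the pointwise almost-everywhere limit of $\widehat\varphi_m$ as $m\to\infty$; it is called the pseudo-spline of order $(\alpha,\ell)$. With $(Df)(x)=\sqrt2 f(2x)$ and $(T_kf)(x)=f(x-k)$, the series \[ \mathscr{P}_nf=\sum_{k\in\mathbb{Z}}\langle f,D^nT_k\varphi\rangle D^nT_k\varphi \] converges unconditionally in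 $L^2(\mathbb{R})$ for all $n\in\mathbb{Z}$ and $f\in L^2(\mathbb{R})$. The operators $\mathscr{P}_n$ provide approximation order $\beta:=\min\{2\alpha,2(\ell+1)\}$, that is, for every $f$ in the Sobolev space $H^{\beta}(\mathbb{R})$, \[ \|f-\mathscr{P}_nf\|_{L^2}=O(2^{-n\beta})\qquad\text{as } n\to\infty . \] -/

import Mathlib

open MeasureTheory Filter Topology
open scoped FourierTransform SchwartzMap

noncomputable section

namespace PseudoSpline

/-- The space `L²(ℝ)` of complex-valued functions. -/
abbrev L2 : Type := Lp ℂ 2 (volume : Measure ℝ)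

/-- The binomial coefficient `Γ(a + 1) / (Γ(k + 1) Γ(a - k + 1))` with a real upper entry. -/
def gammaBinom (a : ℝ) (k : ℕ) : ℝ :=
  Real.Gamma (a + 1) / (Real.Gamma (k + 1) * Real.Gamma (a - k + 1))

/-- The filter `H₀` of order `(α, ℓ)`. -/
def filter (α : ℝ) (ℓ : ℕ) (γ : ℝ) : ℝ :=
  (Real.cos (Real.pi * γ) ^ 2) ^ α *
    ∑ k ∈ Finset.range (ℓ + 1), gammaBinom (α + ℓ) k *
      (Real.sin (Real.pi * γ) ^ 2) ^ k * (Real.cos (Real.pi * γ) ^ 2) ^ (ℓ - k)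

/-- The `m`-th step of the cascade algorithm on the Fourier side: the product
`∏_{j=1}^m H₀(2^{-j} γ)` cut off to the interval `[-2^{m-1}, 2^{m-1}]`. -/
def cascade (α : ℝ) (ℓ m : ℕ) : ℝ → ℝ :=
  Set.indicator (Set.Icc (-((2 : ℝ) ^ m / 2)) ((2 : ℝ) ^ m / 2))
    fun γ => ∏ j ∈ Finset.Icc 1 m, filter α ℓ (γ / 2 ^ j)

/-- `φ ∈ L²(ℝ)` is the (real fractional) pseudo-spline of order `(α, ℓ)`: its Fourier transform,
normalized by `∫ φ(t) e^{-2πitγ} dt`, is the pointwise limit of the cascade algorithm.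
Since the Fourier transform is injective on `L²(ℝ)`, this determines `φ`. -/
def IsPseudoSpline (α : ℝ) (ℓ : ℕ) (φ : L2) : Prop :=
  ∀ᵐ γ : ℝ, Tendsto (fun m : ℕ => ((cascade α ℓ m γ : ℝ) : ℂ)) atTop (𝓝 ((𝓕 φ : L2) γ))

theorem memLp_dilate_translate (φ : L2) (n k : ℤ) :
    MemLp (fun x : ℝ => (((2 : ℝ) ^ ((n : ℝ) / 2) : ℝ) : ℂ) * φ ((2 : ℝ) ^ n * x - k)) 2
      volume := by
  have h2 : (2 : ℝ) ^ n ≠ 0 := by positivity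
  have h1 : MemLp (fun x : ℝ => φ (x - k)) 2 volume :=
    (Lp.memLp φ).comp_measurePreserving (measurePreserving_sub_right volume (k : ℝ))
  have e : MeasurableEmbedding (fun x : ℝ => (2 : ℝ) ^ n * x) :=
    (Homeomorph.mulLeft₀ _ h2).measurableEmbedding
  have h3 : MemLp (fun x : ℝ => φ (x - k)) 2
      (Measure.map (fun x : ℝ => (2 : ℝ) ^ n * x) volume) := by
    have := Real.map_volume_mul_left h2
    rw [this]
    exact h1.smul_measure ENNReal.ofReal_ne_top
  exact (e.memLp_map_measure_iff.1 h3).const_mul _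

/-- `DⁿT_kφ`, where `(D f)(x) = √2 f(2x)` and `(T_k f)(x) = f(x - k)`; that is, the function
`x ↦ 2^{n/2} φ(2ⁿ x - k)`. -/
def dilateTranslate (φ : L2) (n k : ℤ) : L2 := (memLp_dilate_translate φ n k).toLp

/-- The `k`-th term `⟨f, DⁿT_kφ⟩ DⁿT_kφ`. The first slot of Mathlib's `inner` is the
conjugate-linear one. -/
def projTerm (φ : L2) (n : ℤ) (f : L2) (k : ℤ) : L2 :=
  inner ℂ (dilateTranslate φ n k) f • dilateTranslate φ n k

/-- The operator `𝒫ₙ f = ∑_{k ∈ ℤ} ⟨f, DⁿT_kφ⟩ DⁿT_kφ`, the series taken in `L²(ℝ)`. -/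
def proj (φ : L2) (n : ℤ) (f : L2) : L2 := ∑' k : ℤ, projTerm φ n f k

/-- `f ∈ L²(ℝ)` belongs to the Sobolev space `H^β(ℝ)`. -/
def InSobolev (β : ℝ) (f : L2) : Prop :=
  TemperedDistribution.MemSobolev β 2 (f : 𝓢'(ℝ, ℂ))

/-- A sequence of operators on `L²(ℝ)` provides approximation order `β`:
`‖f - Pₙ f‖ = O(2^{-nβ})` as `n → ∞` for every `f ∈ H^β(ℝ)`. -/
def ProvidesApproximationOrder (P : ℤ → L2 → L2) (β : ℝ) : Prop :=
  ∀ f : L2, InSobolev β f →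
    (fun n : ℤ => ‖f - P n f‖) =O[atTop] fun n : ℤ => (2 : ℝ) ^ (-((n : ℝ) * β))

end PseudoSpline

end

noncomputable section

namespace PseudoSpline

open scoped ENNReal InnerProductSpace

/-! Put `v = symbol α ℓ`, the infinite product that is the Fourier transform of `φ`. Its factors lie
in `[0, 1]`, so the partial products decrease and converge everywhere.

The heart is the sub-QMF inequality `H₀(γ)² + H₀(γ + 1/2)² ≤ 1` (`filter_sq_add_sq_le_one`), which
needs `ℓ ≤ α - 1/2`. Iterated over the product it gives `∑ₖ v(γ + k)² ≤ 1`, so `M : C ↦ v · C` is a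
contraction from `L²` of the circle to `L²(ℝ)`. In particular `v = M 1` lies in `L²`, which gives
existence of `φ`. Expanding in the Fourier basis shows that on the Fourier side `𝒫ₙ` is `D⁻ⁿ M M*
Dⁿ`; this also gives unconditional convergence. Hence `‖f - 𝒫ₙ f‖ = ‖h - M M* h‖` with `h = Dⁿ(𝓕 f)`
(`norm_sub_proj`).

The rate comes from two orders of contact: `1 - v(γ) = O(|γ|^(2(ℓ+1)))`, from flatness of `H₀` at
`0`, and `∑_{k≠0} v(γ + k)² = O(|γ|^(4α))`, from the zero of `H₀` at `1/2`. So near frequency `0`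
the multiplier `v` agrees with the indicator of the unit interval, whose `M M*` is the cutoff to
that interval, up to `O(|x|^β)`. This gives `‖h - M M* h‖ ≤ const · ‖w‖` whenever `|x|^β |h| ≤ |w|`
(`norm_sub_apply_adjoint_le`). For `f ∈ H^β`, scaling by `Dⁿ` lets `w` have norm `2^(-nβ)` times a
constant. -/

/-! ### The filter as a function of `y = sin² πγ` on `[0, 1]`. -/

/-- The filter `H₀` as a function of `y = sin² πγ`. -/
def profile (α : ℝ) (ℓ : ℕ) (y : ℝ) : ℝ :=
  (1 - y) ^ α * ∑ k ∈ Finset.range (ℓ + 1), gammaBinom (α + ℓ) k * y ^ k * (1 - y) ^ (ℓ - k)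

lemma filter_eq_profile (α : ℝ) (ℓ : ℕ) (γ : ℝ) :
    filter α ℓ γ = profile α ℓ (Real.sin (Real.pi * γ) ^ 2) := by
  simp only [filter, profile, Real.cos_sq']

lemma gammaBinom_pos {a : ℝ} {k : ℕ} (h : (k : ℝ) < a + 1) : 0 < gammaBinom a k := by
  unfold gammaBinom
  have h0 : (0 : ℝ) ≤ k := k.cast_nonneg
  have h1 := Real.Gamma_pos_of_pos (s := a + 1) (by linarith)
  have h2 := Real.Gamma_pos_of_pos (s := (k : ℝ) + 1) (by linarith)
  have h3 := Real.Gamma_pos_of_pos (s := a - k + 1) (by linarith)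
  positivity

lemma gammaBinom_zero {a : ℝ} (h : 0 < a + 1) : gammaBinom a 0 = 1 := by
  have h1 := (Real.Gamma_pos_of_pos h).ne'
  simp [gammaBinom, h1]

lemma gammaBinom_succ {a : ℝ} {k : ℕ} (h : (k : ℝ) < a) :
    ((k : ℝ) + 1) * gammaBinom a (k + 1) = (a - k) * gammaBinom a k := by
  unfold gammaBinom
  have h0 : (0 : ℝ) ≤ k := k.cast_nonneg
  have h2 := (Real.Gamma_pos_of_pos (s := (k : ℝ) + 1) (by linarith)).ne'
  have h3 := (Real.Gamma_pos_of_pos (s := a - k) (by linarith)).ne'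
  have e1 := Real.Gamma_add_one (s := (k : ℝ) + 1) (by linarith)
  have e2 := Real.Gamma_add_one (s := a - k) (by linarith)
  have e3 : a - (k + 1 : ℕ) + 1 = a - k := by push_cast; ring
  rw [e3, e2, Nat.cast_succ, e1]
  have h4 : (k : ℝ) + 1 ≠ 0 := by linarith
  have h5 : a - k ≠ 0 := by linarith
  field_simp

/-- The derivative telescopes: by `gammaBinom_succ`, the gain from differentiating `y ^ (k + 1)`
cancels the loss from differentiating `(1 - y) ^ (a - k)`, and only the last loss survives. -/
lemma hasDerivAt_sum_gammaBinom {a y : ℝ} (hy : y < 1) {m : ℕ} (hm : (m : ℝ) < a) :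
    HasDerivAt (fun y => ∑ k ∈ Finset.range (m + 1), gammaBinom a k * y ^ k * (1 - y) ^ (a - k))
      (-((a - m) * gammaBinom a m * y ^ m * (1 - y) ^ (a - m - 1))) y := by
  have hterm (k : ℕ) : HasDerivAt (fun y => gammaBinom a k * y ^ k * (1 - y) ^ (a - k))
      (gammaBinom a k * (k * y ^ (k - 1)) * (1 - y) ^ (a - k)
        - (a - k) * gammaBinom a k * y ^ k * (1 - y) ^ (a - k - 1)) y := by
    have h1 : HasDerivAt (fun y : ℝ => (1 - y) ^ (a - k))
        (-1 * (a - k) * (1 - y) ^ (a - k - 1)) y :=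
      ((hasDerivAt_id y).const_sub 1).rpow_const (Or.inl (by simp; linarith))
    refine (((hasDerivAt_pow k y).const_mul (gammaBinom a k)).mul h1).congr_deriv ?_
    ring
  induction m with
  | zero => simpa using hterm 0
  | succ m ih =>
    have hm' : (m : ℝ) < a := by push_cast at hm; linarith
    have e := gammaBinom_succ hm'
    refine (((ih hm').add (hterm (m + 1))).congr_deriv ?_).congr_of_eventuallyEq
      (Eventually.of_forall fun y => Finset.sum_range_succ _ _)
    have e2 : a - m - 1 = a - (m + 1 : ℕ) := by push_cast; ring
    rw [e2, ← e]
    push_cast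
    ring

section

variable {α : ℝ} {ℓ : ℕ}

lemma profile_eq_sum {y : ℝ} (hy : y < 1) :
    profile α ℓ y = ∑ k ∈ Finset.range (ℓ + 1),
      gammaBinom (α + ℓ) k * y ^ k * (1 - y) ^ (α + ℓ - k) := by
  rw [profile, Finset.mul_sum]
  refine Finset.sum_congr rfl fun k hk => ?_
  have hk : k ≤ ℓ := by simpa [Nat.lt_succ_iff] using hk
  have : α + ℓ - k = α + ((ℓ - k : ℕ) : ℝ) := by rw [Nat.cast_sub hk]; ring
  rw [this, Real.rpow_add (by linarith), Real.rpow_natCast]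
  ring

lemma gammaBinom_filter_pos (hα : 1 ≤ α) {k : ℕ} (hk : k ≤ ℓ) : 0 < gammaBinom (α + ℓ) k := by
  have : (k : ℝ) ≤ ℓ := by exact_mod_cast hk
  exact gammaBinom_pos (by linarith)

lemma hasDerivAt_profile (hα : 1 ≤ α) {y : ℝ} (hy : y < 1) :
    HasDerivAt (profile α ℓ) (-(α * gammaBinom (α + ℓ) ℓ * y ^ ℓ * (1 - y) ^ (α - 1))) y := by
  have h := hasDerivAt_sum_gammaBinom (a := α + ℓ) hy (m := ℓ) (by linarith)
  rw [add_sub_cancel_right] at h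
  refine h.congr_of_eventuallyEq ?_
  filter_upwards [eventually_lt_nhds hy] with z hz using profile_eq_sum hz

lemma continuous_profile (hα : 1 ≤ α) : Continuous (profile α ℓ) := by
  unfold profile
  have : Continuous fun y : ℝ => (1 - y) ^ α :=
    (continuous_const.sub continuous_id).rpow_const fun _ => Or.inr (by linarith)
  fun_prop

lemma profile_zero (hα : 1 ≤ α) : profile α ℓ 0 = 1 := by
  have h0 : (0 : ℝ) ≤ ℓ := ℓ.cast_nonneg
  rw [profile, Finset.sum_eq_single 0]
  · simp [gammaBinom_zero (a := α + ℓ) (by linarith)]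
  · intro k _ hk
    simp [hk]
  · simp

lemma profile_nonneg (hα : 1 ≤ α) {y : ℝ} (h0 : 0 ≤ y) (h1 : y ≤ 1) : 0 ≤ profile α ℓ y := by
  have h2 : 0 ≤ 1 - y := by linarith
  refine mul_nonneg (by positivity) (Finset.sum_nonneg fun k hk => ?_)
  have := gammaBinom_filter_pos hα (by simpa [Nat.lt_succ_iff] using hk : k ≤ ℓ)
  positivity

lemma profile_le (hα : 1 ≤ α) {y : ℝ} (h0 : 0 ≤ y) (h1 : y ≤ 1) :
    profile α ℓ y ≤ (∑ k ∈ Finset.range (ℓ + 1), gammaBinom (α + ℓ) k) * (1 - y) ^ α := by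
  have h2 : 0 ≤ 1 - y := by linarith
  rw [profile, mul_comm]
  refine mul_le_mul_of_nonneg_right (Finset.sum_le_sum fun k hk => ?_) (by positivity)
  have := gammaBinom_filter_pos hα (by simpa [Nat.lt_succ_iff] using hk : k ≤ ℓ)
  have h3 : y ^ k * (1 - y) ^ (ℓ - k) ≤ 1 :=
    mul_le_one₀ (pow_le_one₀ h0 h1) (by positivity) (pow_le_one₀ h2 (by linarith))
  rw [mul_assoc]
  nlinarith

lemma antitoneOn_profile (hα : 1 ≤ α) : AntitoneOn (profile α ℓ) (Set.Icc 0 1) := by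
  refine antitoneOn_of_deriv_nonpos (convex_Icc 0 1) (continuous_profile hα).continuousOn ?_ ?_
  · rw [interior_Icc]
    exact fun y hy => (hasDerivAt_profile hα hy.2).differentiableAt.differentiableWithinAt
  · rw [interior_Icc]
    rintro y ⟨hy0, hy1⟩
    rw [(hasDerivAt_profile hα hy1).deriv, neg_nonpos]
    have := gammaBinom_filter_pos hα (le_refl ℓ)
    have : 0 ≤ 1 - y := by linarith
    positivity

lemma profile_le_one (hα : 1 ≤ α) {y : ℝ} (h0 : 0 ≤ y) (h1 : y ≤ 1) : profile α ℓ y ≤ 1 := by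
  rw [← profile_zero (ℓ := ℓ) hα]
  exact antitoneOn_profile hα (by simp) ⟨h0, h1⟩ h0

/-- The derivative of the profile vanishes to order `ℓ` at `0`. Since `α ≥ 1`, the factor `(1 - y) ^
(α - 1)` is at most `1`, so adding `c * y ^ (ℓ + 1)` makes the profile increasing. -/
lemma one_sub_profile_le (hα : 1 ≤ α) {y : ℝ} (h0 : 0 ≤ y) (h1 : y ≤ 1) :
    1 - profile α ℓ y ≤ α * gammaBinom (α + ℓ) ℓ * y ^ (ℓ + 1) := by
  set c := α * gammaBinom (α + ℓ) ℓ
  have hc : 0 ≤ c := by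
    have := gammaBinom_filter_pos hα (le_refl ℓ)
    positivity
  have hd {y : ℝ} (hy : y < 1) : HasDerivAt (fun y => profile α ℓ y + c * y ^ (ℓ + 1))
      (-(c * y ^ ℓ * (1 - y) ^ (α - 1)) + c * ((ℓ + 1 : ℕ) * y ^ ℓ)) y := by
    exact (hasDerivAt_profile hα hy).add ((hasDerivAt_pow (ℓ + 1) y).const_mul c)
  have hm : MonotoneOn (fun y => profile α ℓ y + c * y ^ (ℓ + 1)) (Set.Icc 0 1) := by
    refine monotoneOn_of_deriv_nonneg (convex_Icc 0 1) ?_ ?_ ?_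
    · have := continuous_profile (ℓ := ℓ) hα
      exact Continuous.continuousOn (by fun_prop)
    · rw [interior_Icc]
      exact fun y hy => (hd hy.2).differentiableAt.differentiableWithinAt
    · rw [interior_Icc]
      rintro y ⟨hy0, hy1⟩
      rw [(hd hy1).deriv]
      have h2 : (1 - y) ^ (α - 1) ≤ 1 :=
        Real.rpow_le_one (by linarith) (by linarith) (by linarith)
      have h3 : 0 ≤ c * y ^ ℓ := by positivity
      have h4 : (0 : ℝ) ≤ ℓ := ℓ.cast_nonneg
      push_cast
      nlinarith [mul_nonneg h3 h4, mul_le_mul_of_nonneg_left h2 h3]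
  have := hm (a := 0) (by simp) ⟨h0, h1⟩ h0
  simp only [profile_zero hα] at this
  simp at this
  linarith

/-- The left side equals `1` at `y = 0` and is symmetric about `1/2`, so it suffices that it
decreases on `[0, 1/2]`. -/
lemma profile_sq_add_sq_le_one (hα : 1 ≤ α) (hℓ : (ℓ : ℝ) ≤ α - 1 / 2) {y : ℝ} (h0 : 0 ≤ y)
    (h1 : y ≤ 1) : profile α ℓ y ^ 2 + profile α ℓ (1 - y) ^ 2 ≤ 1 := by
  wlog hy : y ≤ 1 / 2 generalizing y
  · have := this (y := 1 - y) (by linarith) (by linarith) (by linarith)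
    rw [sub_sub_cancel] at this
    linarith
  set c := α * gammaBinom (α + ℓ) ℓ
  have hc : 0 ≤ c := by
    have := gammaBinom_filter_pos hα (le_refl ℓ)
    positivity
  have hd {y : ℝ} (hy0 : 0 < y) (hy : y < 1) :
      HasDerivAt (fun y => profile α ℓ y ^ 2 + profile α ℓ (1 - y) ^ 2)
      (2 * c * ((1 - y) ^ ℓ * y ^ (α - 1) * profile α ℓ (1 - y)
        - y ^ ℓ * (1 - y) ^ (α - 1) * profile α ℓ y)) y := by
    have a1 := (hasDerivAt_profile (ℓ := ℓ) hα hy).pow 2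
    have a2 := hasDerivAt_profile (ℓ := ℓ) hα (y := 1 - y) (by linarith)
    have a3 := (a2.comp y ((hasDerivAt_id y).const_sub 1)).pow 2
    refine (a1.add a3).congr_deriv ?_
    simp only [Function.comp, sub_sub_cancel, c]
    ring
  have hanti : AntitoneOn (fun y => profile α ℓ y ^ 2 + profile α ℓ (1 - y) ^ 2)
      (Set.Icc 0 (1 / 2)) := by
    refine antitoneOn_of_deriv_nonpos (convex_Icc _ _) ?_ ?_ ?_
    · have := continuous_profile (ℓ := ℓ) hα
      exact Continuous.continuousOn (by fun_prop)
    · rw [interior_Icc]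
      exact fun y hy => (hd hy.1 (by linarith [hy.2])).differentiableAt.differentiableWithinAt
    · rw [interior_Icc]
      rintro y ⟨hy0, hy1⟩
      have hy2 : 0 < 1 - y := by linarith
      rw [(hd hy0 (by linarith)).deriv]
      refine mul_nonpos_of_nonneg_of_nonpos (by positivity) (sub_nonpos.2 ?_)
      -- Both terms of the derivative take this form, with `(u, v)` equal to `(y, 1 - y)` or `(1 -
      -- y, y)`. The factor `(u * v) ^ ℓ` is common; the rest compares factor by factor because `y ≤
      -- 1 - y`, the exponent `2 * α - 1 - 2 * ℓ` is nonnegative, and `2 * ℓ - k ≥ k`.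
      have key {u v : ℝ} (hu : 0 < u) (hv : 0 < v) (huv : v = 1 - u) :
          u ^ ℓ * v ^ (α - 1) * profile α ℓ u = (u * v) ^ ℓ * v ^ (2 * α - 1 - 2 * ℓ) *
            ∑ k ∈ Finset.range (ℓ + 1), gammaBinom (α + ℓ) k * (u ^ k * v ^ (2 * ℓ - k)) := by
        have e : v ^ (α - 1) * v ^ α = v ^ (2 * α - 1 - 2 * ℓ) * v ^ ℓ * v ^ ℓ := by
          rw [← Real.rpow_add hv, mul_assoc, ← pow_add, ← Real.rpow_natCast, ← Real.rpow_add hv]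
          congr 1
          push_cast
          ring
        rw [profile, ← huv, show u ^ ℓ * v ^ (α - 1) * (v ^ α * ∑ k ∈ Finset.range (ℓ + 1),
          gammaBinom (α + ℓ) k * u ^ k * v ^ (ℓ - k)) = u ^ ℓ * (v ^ (α - 1) * v ^ α) *
          ∑ k ∈ Finset.range (ℓ + 1), gammaBinom (α + ℓ) k * u ^ k * v ^ (ℓ - k) by ring, e,
          mul_pow, Finset.mul_sum, Finset.mul_sum]
        refine Finset.sum_congr rfl fun k hk => ?_
        have hk : k ≤ ℓ := by simpa [Nat.lt_succ_iff] using hk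
        rw [show 2 * ℓ - k = ℓ + (ℓ - k) by omega, pow_add]
        ring
      rw [key hy0 hy2 rfl]
      have := key hy2 hy0 (by ring)
      rw [this, mul_comm (1 - y) y]
      have hS : 0 ≤ ∑ k ∈ Finset.range (ℓ + 1),
          gammaBinom (α + ℓ) k * ((1 - y) ^ k * y ^ (2 * ℓ - k)) := by
        refine Finset.sum_nonneg fun k hk => ?_
        have := gammaBinom_filter_pos hα (by simpa [Nat.lt_succ_iff] using hk : k ≤ ℓ)
        positivity
      refine mul_le_mul (mul_le_mul_of_nonneg_left ?_ (by positivity))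
        (Finset.sum_le_sum fun k hk => ?_) hS (by positivity)
      · exact Real.rpow_le_rpow hy0.le (by linarith) (by linarith)
      · have hk : k ≤ ℓ := by simpa [Nat.lt_succ_iff] using hk
        refine mul_le_mul_of_nonneg_left ?_ (gammaBinom_filter_pos hα hk).le
        rw [show 2 * ℓ - k = k + (2 * ℓ - 2 * k) by omega, pow_add, pow_add, ← mul_assoc,
          ← mul_assoc, mul_comm ((1 - y) ^ k)]
        exact mul_le_mul_of_nonneg_left (pow_le_pow_left₀ hy0.le (by linarith) _) (by positivity)
  have h2 := hanti (a := 0) (by simp) ⟨h0, hy⟩ h0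
  have h3 : profile α ℓ 1 = 0 := by simp [profile, Real.zero_rpow (by linarith : α ≠ 0)]
  simp only [profile_zero hα, sub_zero, h3] at h2
  simpa using h2

/-! ### Bounds for the filter, near `0` and near `1/2`. -/

lemma filter_nonneg (hα : 1 ≤ α) (γ : ℝ) : 0 ≤ filter α ℓ γ := by
  rw [filter_eq_profile]
  exact profile_nonneg hα (sq_nonneg _) (Real.sin_sq_le_one _)

lemma filter_le_one (hα : 1 ≤ α) (γ : ℝ) : filter α ℓ γ ≤ 1 := by
  rw [filter_eq_profile]
  exact profile_le_one hα (sq_nonneg _) (Real.sin_sq_le_one _)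

lemma continuous_filter (hα : 1 ≤ α) : Continuous (filter α ℓ) := by
  have := continuous_profile (ℓ := ℓ) hα
  simp only [funext (filter_eq_profile α ℓ)]
  fun_prop

lemma filter_add_int (γ : ℝ) (k : ℤ) : filter α ℓ (γ + k) = filter α ℓ γ := by
  rw [filter_eq_profile, filter_eq_profile, mul_add, mul_comm Real.pi (k : ℝ), Real.sin_sq,
    Real.sin_sq, Real.cos_sq, Real.cos_sq,
    show 2 * (Real.pi * γ + k * Real.pi) = 2 * (Real.pi * γ) + k * (2 * Real.pi) by ring,
    Real.cos_add_int_mul_two_pi]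

lemma sin_sq_add_half (γ : ℝ) :
    Real.sin (Real.pi * (γ + 1 / 2)) ^ 2 = 1 - Real.sin (Real.pi * γ) ^ 2 := by
  rw [show Real.pi * (γ + 1 / 2) = Real.pi * γ + Real.pi / 2 by ring, Real.sin_add_pi_div_two,
    Real.cos_sq']

lemma filter_sq_add_sq_le_one (hα : 1 ≤ α) (hℓ : (ℓ : ℝ) ≤ α - 1 / 2) (γ : ℝ) :
    filter α ℓ γ ^ 2 + filter α ℓ (γ + 1 / 2) ^ 2 ≤ 1 := by
  rw [filter_eq_profile, filter_eq_profile, sin_sq_add_half]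
  exact profile_sq_add_sq_le_one hα hℓ (sq_nonneg _) (Real.sin_sq_le_one _)

lemma sin_pi_mul_sq_le (γ : ℝ) : Real.sin (Real.pi * γ) ^ 2 ≤ (Real.pi * |γ|) ^ 2 := by
  have h := Real.abs_sin_le_abs (x := Real.pi * γ)
  rw [abs_mul, abs_of_pos Real.pi_pos] at h
  rw [← sq_abs (Real.sin _)]
  exact pow_le_pow_left₀ (abs_nonneg _) h 2

lemma exists_one_sub_filter_le (hα : 1 ≤ α) :
    ∃ C, 0 ≤ C ∧ ∀ γ, 1 - filter α ℓ γ ≤ C * |γ| ^ (2 * (ℓ + 1)) := by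
  have hc := gammaBinom_filter_pos hα (le_refl ℓ)
  have hp := Real.pi_pos
  refine ⟨α * gammaBinom (α + ℓ) ℓ * Real.pi ^ (2 * (ℓ + 1)), by positivity, fun γ => ?_⟩
  rw [filter_eq_profile]
  refine (one_sub_profile_le hα (sq_nonneg _) (Real.sin_sq_le_one _)).trans ?_
  rw [mul_assoc _ (Real.pi ^ _), ← mul_pow, pow_mul]
  refine mul_le_mul_of_nonneg_left ?_ (by positivity)
  exact pow_le_pow_left₀ (sq_nonneg _) (sin_pi_mul_sq_le γ) _

/-- At `γ + 1/2` the factor `(1 - y) ^ α` becomes `(sin² πγ) ^ α`: a zero of order `2 * α`. -/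
lemma exists_filter_add_half_le (hα : 1 ≤ α) :
    ∃ C, 0 ≤ C ∧ ∀ γ, filter α ℓ (γ + 1 / 2) ≤ C * |γ| ^ (2 * α) := by
  have hp := Real.pi_pos
  have hS : 0 ≤ ∑ k ∈ Finset.range (ℓ + 1), gammaBinom (α + ℓ) k :=
    Finset.sum_nonneg fun k hk =>
      (gammaBinom_filter_pos hα (by simpa [Nat.lt_succ_iff] using hk : k ≤ ℓ)).le
  refine ⟨(∑ k ∈ Finset.range (ℓ + 1), gammaBinom (α + ℓ) k) * Real.pi ^ (2 * α),
    by positivity, fun γ => ?_⟩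
  rw [filter_eq_profile]
  refine (profile_le hα (sq_nonneg _) (Real.sin_sq_le_one _)).trans ?_
  rw [mul_assoc, sin_sq_add_half, sub_sub_cancel, ← Real.mul_rpow hp.le (abs_nonneg _)]
  refine mul_le_mul_of_nonneg_left ?_ hS
  rw [Real.rpow_mul (by positivity)]
  refine Real.rpow_le_rpow (sq_nonneg _) ?_ (by linarith)
  exact_mod_cast sin_pi_mul_sq_le γ

end

/-! ### The infinite product and its integer translates. -/

section

/-- The product `∏_{j=1}^m H₀(2^{-j} γ)`, without cutoff. -/
def partialProd (α : ℝ) (ℓ m : ℕ) (γ : ℝ) : ℝ :=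
  ∏ j ∈ Finset.Icc 1 m, filter α ℓ (γ / 2 ^ j)

/-- The infinite product `∏_{j≥1} H₀(2^{-j} γ)`. -/
def symbol (α : ℝ) (ℓ : ℕ) (γ : ℝ) : ℝ := ⨅ m, partialProd α ℓ m γ

variable {α : ℝ} {ℓ : ℕ}

lemma partialProd_zero (γ : ℝ) : partialProd α ℓ 0 γ = 1 := by simp [partialProd]

lemma partialProd_succ (m : ℕ) (γ : ℝ) :
    partialProd α ℓ (m + 1) γ = partialProd α ℓ m γ * filter α ℓ (γ / 2 ^ (m + 1)) := by
  simp [partialProd, Finset.prod_Icc_succ_top]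

lemma partialProd_succ' (m : ℕ) (γ : ℝ) :
    partialProd α ℓ (m + 1) γ = filter α ℓ (γ / 2) * partialProd α ℓ m (γ / 2) := by
  induction m with
  | zero => simp [partialProd]
  | succ m ih =>
    rw [partialProd_succ, ih, partialProd_succ m (γ / 2), mul_assoc, pow_succ' 2 (m + 1),
      ← div_div]

lemma partialProd_nonneg (hα : 1 ≤ α) (m : ℕ) (γ : ℝ) : 0 ≤ partialProd α ℓ m γ :=
  Finset.prod_nonneg fun _ _ => filter_nonneg hα _

lemma partialProd_le_one (hα : 1 ≤ α) (m : ℕ) (γ : ℝ) : partialProd α ℓ m γ ≤ 1 :=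
  Finset.prod_le_one (fun _ _ => filter_nonneg hα _) fun _ _ => filter_le_one hα _

lemma antitone_partialProd (hα : 1 ≤ α) (γ : ℝ) : Antitone fun m => partialProd α ℓ m γ :=
  antitone_nat_of_succ_le fun m => by
    rw [partialProd_succ]
    exact mul_le_of_le_one_right (partialProd_nonneg hα m γ) (filter_le_one hα _)

lemma bddBelow_partialProd (hα : 1 ≤ α) (γ : ℝ) :
    BddBelow (Set.range fun m => partialProd α ℓ m γ) :=
  ⟨0, by rintro _ ⟨m, rfl⟩; exact partialProd_nonneg hα m γ⟩

lemma tendsto_partialProd (hα : 1 ≤ α) (γ : ℝ) :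
    Tendsto (fun m => partialProd α ℓ m γ) atTop (𝓝 (symbol α ℓ γ)) :=
  tendsto_atTop_ciInf (antitone_partialProd hα γ) (bddBelow_partialProd hα γ)

lemma tendsto_cascade (hα : 1 ≤ α) (γ : ℝ) :
    Tendsto (fun m => cascade α ℓ m γ) atTop (𝓝 (symbol α ℓ γ)) := by
  refine (tendsto_partialProd hα γ).congr' ?_
  have h : Tendsto (fun m : ℕ => (2 : ℝ) ^ m / 2) atTop atTop :=
    (tendsto_pow_atTop_atTop_of_one_lt one_lt_two).atTop_div_const two_pos
  filter_upwards [h.eventually_ge_atTop |γ|] with m hm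
  rw [cascade, Set.indicator_of_mem (Set.mem_Icc.2 (abs_le.1 hm)), partialProd]

lemma symbol_nonneg (hα : 1 ≤ α) (γ : ℝ) : 0 ≤ symbol α ℓ γ :=
  le_ciInf fun m => partialProd_nonneg hα m γ

lemma symbol_le_partialProd (hα : 1 ≤ α) (m : ℕ) (γ : ℝ) : symbol α ℓ γ ≤ partialProd α ℓ m γ :=
  ciInf_le (bddBelow_partialProd hα γ) m

lemma symbol_le_one (hα : 1 ≤ α) (γ : ℝ) : symbol α ℓ γ ≤ 1 :=
  (symbol_le_partialProd hα 0 γ).trans (partialProd_le_one hα 0 γ)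

lemma measurable_symbol (hα : 1 ≤ α) : Measurable (symbol α ℓ) := by
  refine Measurable.iInf fun m => ?_
  unfold partialProd
  have := (continuous_filter (ℓ := ℓ) hα).measurable
  fun_prop

/-- The `j`-th factor has period `2 ^ j`, which divides `2 ^ m` for `j ≤ m`. -/
lemma partialProd_add_mul (m : ℕ) (γ : ℝ) (k : ℤ) :
    partialProd α ℓ m (γ + k * 2 ^ m) = partialProd α ℓ m γ := by
  refine Finset.prod_congr rfl fun j hj => ?_
  have hj : j ≤ m := (Finset.mem_Icc.1 hj).2
  rw [← filter_add_int (γ / 2 ^ j) (k * 2 ^ (m - j))]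
  congr 1
  push_cast
  rw [add_div, mul_div_assoc, ← pow_sub₀ _ two_ne_zero hj |>.trans (div_eq_mul_inv _ _).symm]

lemma sum_range_two_mul (f : ℕ → ℝ) (n : ℕ) :
    ∑ j ∈ Finset.range (2 * n), f j = ∑ i ∈ Finset.range n, (f (2 * i) + f (2 * i + 1)) := by
  induction n with
  | zero => simp
  | succ n ih => rw [mul_add, mul_one, Finset.sum_range_succ, Finset.sum_range_succ, ih,
      Finset.sum_range_succ, add_assoc]

/-- Peel off the factor `j = 1`. By periodicity it is `H₀(γ/2)` on all even translates and `H₀(γ/2 +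
1/2)` on all odd ones; the remaining sums are of the same kind one level down. -/
lemma sum_partialProd_sq_le_one (hα : 1 ≤ α) (hℓ : (ℓ : ℝ) ≤ α - 1 / 2) (m : ℕ) (γ : ℝ) :
    ∑ j ∈ Finset.range (2 ^ m), partialProd α ℓ m (γ + j) ^ 2 ≤ 1 := by
  induction m generalizing γ with
  | zero => simp [partialProd_zero]
  | succ m ih =>
    have e0 (i : ℕ) : partialProd α ℓ (m + 1) (γ + (2 * i : ℕ)) =
        filter α ℓ (γ / 2) * partialProd α ℓ m (γ / 2 + i) := by
      rw [partialProd_succ', show (γ + (2 * i : ℕ)) / 2 = γ / 2 + i by push_cast; ring]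
      exact congrArg (· * _) (filter_add_int _ (i : ℤ))
    have e1 (i : ℕ) : partialProd α ℓ (m + 1) (γ + (2 * i + 1 : ℕ)) =
        filter α ℓ (γ / 2 + 1 / 2) * partialProd α ℓ m (γ / 2 + 1 / 2 + i) := by
      rw [partialProd_succ',
        show (γ + (2 * i + 1 : ℕ)) / 2 = γ / 2 + 1 / 2 + i by push_cast; ring]
      exact congrArg (· * _) (filter_add_int _ (i : ℤ))
    rw [pow_succ', sum_range_two_mul, Finset.sum_add_distrib]
    simp only [e0, e1, mul_pow, ← Finset.mul_sum]
    refine le_trans (add_le_add (mul_le_of_le_one_right (sq_nonneg _) (ih _))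
      (mul_le_of_le_one_right (sq_nonneg _) (ih _))) (filter_sq_add_sq_le_one hα hℓ _)

/-- Same even/odd splitting. Nonzero even translates reduce to the same sum at `γ/2`; odd ones carry
the small factor `H₀(γ/2 + 1/2)`. Each part is at most `(X / 2) ^ 2` with `X = C * |γ| ^ (2 * α)`,
because `2 ^ (2 * α) ≥ 2`, so the constant `C` does not grow with `m`. -/
lemma sum_partialProd_sq_le (hα : 1 ≤ α) (hℓ : (ℓ : ℝ) ≤ α - 1 / 2) {C : ℝ} (hC : 0 ≤ C)
    (h : ∀ γ, filter α ℓ (γ + 1 / 2) ≤ C * |γ| ^ (2 * α)) (m : ℕ) (γ : ℝ) :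
    ∑ j ∈ Finset.range (2 ^ m), (if j = 0 then 0 else partialProd α ℓ m (γ + j) ^ 2) ≤
      (C * |γ| ^ (2 * α)) ^ 2 := by
  induction m generalizing γ with
  | zero => simpa using sq_nonneg _
  | succ m ih =>
    have e0 (i : ℕ) : (if 2 * i = 0 then 0 else partialProd α ℓ (m + 1) (γ + (2 * i : ℕ)) ^ 2) ≤
        if i = 0 then 0 else partialProd α ℓ m (γ / 2 + i) ^ 2 := by
      rcases eq_or_ne i 0 with rfl | hi
      · simp
      rw [if_neg (by omega), if_neg hi, partialProd_succ',
        show (γ + (2 * i : ℕ)) / 2 = γ / 2 + i by push_cast; ring, mul_pow]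
      exact mul_le_of_le_one_left (sq_nonneg _)
        (pow_le_one₀ (filter_nonneg hα _) (filter_le_one hα _))
    have e1 (i : ℕ) : (if 2 * i + 1 = 0 then 0 else
        partialProd α ℓ (m + 1) (γ + (2 * i + 1 : ℕ)) ^ 2) =
        filter α ℓ (γ / 2 + 1 / 2) ^ 2 * partialProd α ℓ m (γ / 2 + 1 / 2 + i) ^ 2 := by
      rw [if_neg (by omega), partialProd_succ',
        show (γ + (2 * i + 1 : ℕ)) / 2 = γ / 2 + 1 / 2 + i by push_cast; ring, ← mul_pow]
      exact congrArg (fun t => (t * _) ^ 2) (filter_add_int _ (i : ℤ))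
    rw [pow_succ', sum_range_two_mul, Finset.sum_add_distrib]
    simp only [e1, ← Finset.mul_sum]
    refine le_trans (add_le_add ((Finset.sum_le_sum fun i _ => e0 i).trans (ih _))
      ((mul_le_of_le_one_right (sq_nonneg _) (sum_partialProd_sq_le_one hα hℓ m _)).trans
        (pow_le_pow_left₀ (filter_nonneg hα _) (h _) 2))) ?_
    have e2 : |γ / 2| ^ (2 * α) ≤ |γ| ^ (2 * α) / 2 := by
      rw [abs_div, abs_two, Real.div_rpow (abs_nonneg _) two_pos.le]
      refine div_le_div_of_nonneg_left (by positivity) two_pos ?_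
      calc (2 : ℝ) = 2 ^ (1 : ℝ) := (Real.rpow_one 2).symm
        _ ≤ 2 ^ (2 * α) := Real.rpow_le_rpow_of_exponent_le one_le_two (by linarith)
    have e3 : C * |γ / 2| ^ (2 * α) ≤ C * |γ| ^ (2 * α) / 2 := by
      rw [mul_div_assoc]
      exact mul_le_mul_of_nonneg_left e2 hC
    have e4 := pow_le_pow_left₀ (by positivity) e3 2
    nlinarith [sq_nonneg (C * |γ| ^ (2 * α))]

/-- Lets finite sums over `ℤ` of translates of `symbol` be dominated by sums over residues modulo `2
^ m` of translates of `partialProd`. -/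
lemma exists_injOn_emod_two_pow (s : Finset ℤ) :
    ∃ m : ℕ, Set.InjOn (fun j : ℤ => (j % 2 ^ m).toNat) s := by
  obtain ⟨M, hM⟩ := (s.image Int.natAbs).bddAbove
  refine ⟨M + 1, fun j hj k hk hjk => ?_⟩
  have hj' : j.natAbs ≤ M := hM (Finset.mem_coe.2 (Finset.mem_image_of_mem _ hj))
  have hk' : k.natAbs ≤ M := hM (Finset.mem_coe.2 (Finset.mem_image_of_mem _ hk))
  have hp : (0 : ℤ) < 2 ^ (M + 1) := by positivity
  have h1 : j % 2 ^ (M + 1) = k % 2 ^ (M + 1) := by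
    have a1 := Int.emod_nonneg j hp.ne'
    have a2 := Int.emod_nonneg k hp.ne'
    simp only at hjk
    omega
  have h2 : (2 : ℤ) ^ (M + 1) ∣ j - k := Int.ModEq.dvd (Eq.symm h1)
  have h3 : (M : ℤ) < 2 ^ M := by exact_mod_cast Nat.lt_two_pow_self
  have h4 : |j - k| < 2 ^ (M + 1) := by
    rw [pow_succ, abs_lt]
    omega
  exact sub_eq_zero.1 (Int.eq_zero_of_abs_lt_dvd h2 h4)

lemma symbol_le_partialProd_emod (hα : 1 ≤ α) (m : ℕ) (γ : ℝ) (j : ℤ) :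
    symbol α ℓ (γ + j) ≤ partialProd α ℓ m (γ + (j % 2 ^ m).toNat) := by
  have hp : (0 : ℤ) < 2 ^ m := by positivity
  refine (symbol_le_partialProd hα m _).trans_eq ?_
  rw [← partialProd_add_mul m (γ + (j % 2 ^ m).toNat) (j / 2 ^ m), add_assoc]
  congr 2
  have h1 : (((j % 2 ^ m).toNat : ℤ) : ℝ) = ((j % 2 ^ m : ℤ) : ℝ) := by
    rw [Int.toNat_of_nonneg (Int.emod_nonneg j hp.ne')]
  rw [Int.cast_natCast] at h1
  rw [h1]
  have h2 : ((j % 2 ^ m : ℤ) : ℝ) + 2 ^ m * ((j / 2 ^ m : ℤ) : ℝ) = j := by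
    exact_mod_cast Int.emod_add_mul_ediv j (2 ^ m)
  linarith

lemma sum_comp_emod_le {s : Finset ℤ} {m : ℕ}
    (hs : Set.InjOn (fun j : ℤ => (j % 2 ^ m).toNat) s) {f : ℕ → ℝ} (hf : ∀ i, 0 ≤ f i) :
    ∑ j ∈ s, f (j % 2 ^ m).toNat ≤ ∑ i ∈ Finset.range (2 ^ m), f i := by
  rw [← Finset.sum_image (f := f) hs]
  refine Finset.sum_le_sum_of_subset_of_nonneg ?_ fun i _ _ => hf i
  intro i hi
  obtain ⟨j, -, rfl⟩ := Finset.mem_image.1 hi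
  have hp : (0 : ℤ) < 2 ^ m := by positivity
  have := Int.emod_lt_of_pos j hp
  rw [Finset.mem_range, Int.toNat_lt' (by positivity)]
  exact_mod_cast this

lemma sum_symbol_sq_le_one (hα : 1 ≤ α) (hℓ : (ℓ : ℝ) ≤ α - 1 / 2) (γ : ℝ) (s : Finset ℤ) :
    ∑ j ∈ s, symbol α ℓ (γ + j) ^ 2 ≤ 1 := by
  obtain ⟨m, hm⟩ := exists_injOn_emod_two_pow s
  refine le_trans (Finset.sum_le_sum fun j _ => ?_)
    ((sum_comp_emod_le hm (f := fun i => partialProd α ℓ m (γ + i) ^ 2)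
      fun i => sq_nonneg _).trans (sum_partialProd_sq_le_one hα hℓ m γ))
  exact pow_le_pow_left₀ (symbol_nonneg hα _) (symbol_le_partialProd_emod hα m γ j) 2

lemma exists_sum_symbol_sq_le (hα : 1 ≤ α) (hℓ : (ℓ : ℝ) ≤ α - 1 / 2) :
    ∃ C, 0 ≤ C ∧ ∀ (γ : ℝ) (s : Finset ℤ), 0 ∉ s →
      ∑ j ∈ s, symbol α ℓ (γ + j) ^ 2 ≤ (C * |γ| ^ (2 * α)) ^ 2 := by
  obtain ⟨C, hC, h⟩ := exists_filter_add_half_le (ℓ := ℓ) hα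
  refine ⟨C, hC, fun γ s hs => ?_⟩
  obtain ⟨m, hm⟩ := exists_injOn_emod_two_pow (insert 0 s)
  have hm' : Set.InjOn (fun j : ℤ => (j % 2 ^ m).toNat) s := hm.mono (by simp)
  refine le_trans (Finset.sum_le_sum fun j hj => ?_)
    ((sum_comp_emod_le hm' (f := fun i => if i = 0 then 0 else partialProd α ℓ m (γ + i) ^ 2)
      fun i => by positivity).trans (sum_partialProd_sq_le hα hℓ hC h m γ))
  have hj0 : (j % 2 ^ m).toNat ≠ 0 := fun h0 => by
    have : j = 0 := hm (by simp [hj]) (by simp) (by simpa using h0)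
    exact hs (this ▸ hj)
  rw [if_neg hj0]
  exact pow_le_pow_left₀ (symbol_nonneg hα _) (symbol_le_partialProd_emod hα m γ j) 2

/-- For factors in `[0, 1]`, one minus the product is at most the sum of the defects. Their scaling
is weakened to `2 ^ (-j)`, so they sum to a geometric series, whose partial sum is the `1 - (1 / 2)
^ m` below. -/
lemma exists_one_sub_symbol_le (hα : 1 ≤ α) :
    ∃ C, 0 ≤ C ∧ ∀ γ, 1 - symbol α ℓ γ ≤ C * |γ| ^ (2 * (ℓ + 1)) := by
  obtain ⟨C, hC, h⟩ := exists_one_sub_filter_le (ℓ := ℓ) hα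
  refine ⟨C, hC, fun γ => ?_⟩
  have key (m : ℕ) : 1 - partialProd α ℓ m γ ≤ C * |γ| ^ (2 * (ℓ + 1)) * (1 - (1 / 2) ^ m) := by
    induction m with
    | zero => simp [partialProd_zero]
    | succ m ih =>
      rw [partialProd_succ]
      have h1 := h (γ / 2 ^ (m + 1))
      have h2 : |γ / 2 ^ (m + 1)| ^ (2 * (ℓ + 1)) ≤ |γ| ^ (2 * (ℓ + 1)) * (1 / 2) ^ (m + 1) := by
        have h3 : |γ / 2 ^ (m + 1)| = |γ| * (1 / 2) ^ (m + 1) := by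
          rw [abs_div, abs_of_pos (by positivity : (0 : ℝ) < 2 ^ (m + 1)), one_div, inv_pow,
            div_eq_mul_inv]
        rw [h3, mul_pow]
        refine mul_le_mul_of_nonneg_left ?_ (by positivity)
        exact pow_le_of_le_one (by positivity) (pow_le_one₀ (by norm_num) (by norm_num)) (by omega)
      have h4 := mul_le_mul_of_nonneg_left h2 hC
      have h5 := partialProd_le_one (ℓ := ℓ) hα m γ
      have h6 := partialProd_nonneg (ℓ := ℓ) hα m γ
      have h7 := filter_le_one (ℓ := ℓ) hα (γ / 2 ^ (m + 1))
      have h8 : (1 / 2 : ℝ) ^ m = 2 * (1 / 2) ^ (m + 1) := by rw [pow_succ]; ring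
      nlinarith [mul_le_mul_of_nonneg_right h5 (sub_nonneg.2 h7)]
  refine le_of_tendsto ((tendsto_partialProd hα γ).const_sub 1) (Eventually.of_forall fun m => ?_)
  refine (key m).trans (mul_le_of_le_one_right (by positivity) ?_)
  have : (0 : ℝ) ≤ (1 / 2) ^ m := by positivity
  linarith

end

/-! ### Periodization, and multiplication operators from the circle to the line. -/

lemma enorm_sq_eq_lintegral {X : Type*} [MeasurableSpace X] {μ : Measure X} (f : Lp ℂ 2 μ) :
    ‖f‖ₑ ^ 2 = ∫⁻ x, ‖f x‖ₑ ^ 2 ∂μ := by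
  have h := eLpNorm_nnreal_pow_eq_lintegral (f := f) (μ := μ) (p := 2) two_ne_zero
  rw [Lp.enorm_def]
  simpa using h

lemma norm_le_mul_of_enorm_sq_le {E F : Type*} [SeminormedAddCommGroup E]
    [SeminormedAddCommGroup F] {x : E} {y : F} {c : ℝ} (hc : 0 ≤ c)
    (h : ‖x‖ₑ ^ 2 ≤ ENNReal.ofReal c ^ 2 * ‖y‖ₑ ^ 2) : ‖x‖ ≤ c * ‖y‖ := by
  rw [← mul_pow, ENNReal.pow_le_pow_left_iff two_ne_zero, ← ofReal_norm, ← ofReal_norm,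
    ← ENNReal.ofReal_mul hc] at h
  exact (ENNReal.ofReal_le_ofReal_iff (by positivity)).1 h

/-- Unfolding an integral over the line to the unit interval centred at `0`. -/
lemma lintegral_eq_lintegral_tsum {f : ℝ → ℝ≥0∞} (hf : Measurable f) :
    ∫⁻ x, f x = ∫⁻ x in Set.Ioc (-1 / 2 : ℝ) (1 / 2), ∑' k : ℤ, f (x + k) := by
  have hI : Set.Ioc (-1 / 2 : ℝ) (1 / 2) = Set.Ioc (-1 / 2 : ℝ) (-1 / 2 + 1) := by norm_num
  rw [(isAddFundamentalDomain_Ioc one_pos (-1 / 2 : ℝ) volume).lintegral_eq_tsum' f,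
    lintegral_tsum (fun k => by fun_prop), hI]
  let e : ℤ → AddSubgroup.zmultiples (1 : ℝ) := fun n => ⟨n • 1, n, rfl⟩
  have he : Function.Bijective e := by
    refine ⟨fun m n h => ?_, fun ⟨x, n, hn⟩ => ⟨n, Subtype.ext hn⟩⟩
    have := congrArg Subtype.val h
    simpa [e] using this
  -- The fundamental-domain formula translates by `-g`, hence the sign change in the index.
  rw [← ((Equiv.neg ℤ).trans (Equiv.ofBijective e he)).tsum_eq]
  refine tsum_congr fun k => lintegral_congr fun x => congrArg f ?_
  simp [e, AddSubgroup.vadd_def, add_comm]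

lemma lintegral_periodic_mul {F : UnitAddCircle → ℝ≥0∞} (hF : Measurable F) {w : ℝ → ℝ≥0∞}
    (hw : Measurable w) : ∫⁻ x : ℝ, F x * w x =
      ∫⁻ x in Set.Ioc (-1 / 2 : ℝ) (1 / 2), F x * ∑' k : ℤ, w (x + k) := by
  have hF' : Measurable fun x : ℝ => F x := hF.comp AddCircle.measurable_mk'
  rw [lintegral_eq_lintegral_tsum (f := fun x => F x * w x) (hF'.mul hw)]
  refine lintegral_congr fun x => ?_
  rw [← ENNReal.tsum_mul_left]
  refine tsum_congr fun k => ?_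
  have : ((k : ℝ) : UnitAddCircle) = 0 := (AddCircle.coe_eq_zero_iff 1).2 ⟨k, by simp⟩
  rw [AddCircle.coe_add, this, add_zero]

lemma haarAddCircle_eq_volume :
    (AddCircle.haarAddCircle : Measure UnitAddCircle) = volume := by
  rw [AddCircle.volume_eq_smul_haarAddCircle, ENNReal.ofReal_one, one_smul]

lemma lintegral_Ioc_eq_haarAddCircle (F : UnitAddCircle → ℝ≥0∞) :
    ∫⁻ x in Set.Ioc (-1 / 2 : ℝ) (1 / 2), F x = ∫⁻ y, F y ∂AddCircle.haarAddCircle := by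
  rw [haarAddCircle_eq_volume, ← UnitAddCircle.lintegral_preimage (-1 / 2)]
  norm_num

/-- Transfers almost-everywhere statements from the circle to the line. The preimage of a null set
has measure `0 * ∞ = 0` by unfolding with the constant weight `1`. -/
lemma quasiMeasurePreserving_coe_addCircle :
    Measure.QuasiMeasurePreserving ((↑) : ℝ → UnitAddCircle) volume
      AddCircle.haarAddCircle := by
  refine ⟨AddCircle.measurable_mk', Measure.AbsolutelyContinuous.mk fun s hs h0 => ?_⟩
  rw [Measure.map_apply AddCircle.measurable_mk' hs, ← lintegral_indicator_one
    (AddCircle.measurable_mk' hs)]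
  have h := lintegral_periodic_mul (measurable_one.indicator hs) (w := 1) measurable_one
  simp only [Pi.one_apply, mul_one] at h
  refine Eq.trans h ?_
  have h2 := lintegral_Ioc_eq_haarAddCircle (s.indicator 1 * fun _ => ∑' _ : ℤ, 1)
  refine Eq.trans h2 ?_
  simp only [Pi.mul_apply]
  rw [lintegral_mul_const _ (measurable_one.indicator hs), lintegral_indicator_one hs, h0, zero_mul]

/-- Square-integrable functions on the circle. -/
abbrev L2Circle : Type := Lp ℂ 2 (AddCircle.haarAddCircle : Measure UnitAddCircle)

lemma tsum_enorm_sq_le {a : ℤ → ℝ} {c : ℝ} (h : ∀ s : Finset ℤ, ∑ j ∈ s, a j ^ 2 ≤ c) :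
    ∑' j, ‖a j‖ₑ ^ 2 ≤ ENNReal.ofReal c := by
  rw [ENNReal.tsum_eq_iSup_sum]
  refine iSup_le fun s => ?_
  refine le_trans (le_of_eq ?_) (ENNReal.ofReal_le_ofReal (h s))
  rw [ENNReal.ofReal_sum_of_nonneg fun _ _ => sq_nonneg _]
  refine Finset.sum_congr rfl fun j _ => ?_
  rw [Real.enorm_eq_ofReal_abs, ← ENNReal.ofReal_pow (abs_nonneg _), sq_abs]

lemma lintegral_mul_periodic (C : L2Circle) {v : ℝ → ℝ} (hv : Measurable v) :
    ∫⁻ x : ℝ, ‖(v x : ℂ) * C x‖ₑ ^ 2 =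
      ∫⁻ x in Set.Ioc (-1 / 2 : ℝ) (1 / 2), ‖C x‖ₑ ^ 2 * ∑' k : ℤ, ‖v (x + k)‖ₑ ^ 2 := by
  have hC := (Lp.stronglyMeasurable C).measurable
  rw [← lintegral_periodic_mul (F := fun y => ‖C y‖ₑ ^ 2) (w := fun x => ‖v x‖ₑ ^ 2)
    (by fun_prop) (by fun_prop)]
  refine lintegral_congr fun x => ?_
  rw [enorm_mul, mul_pow, mul_comm]
  rw [← ofReal_norm (v x : ℂ), Complex.norm_real, ofReal_norm]

/-- The translates of `v` by integers have square sum at most `1`. -/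
def IsPeriodicMultiplier (v : ℝ → ℝ) : Prop :=
  Measurable v ∧ ∀ (x : ℝ) (s : Finset ℤ), ∑ j ∈ s, v (x + j) ^ 2 ≤ 1

lemma IsPeriodicMultiplier.lintegral_le {v : ℝ → ℝ} (hv : IsPeriodicMultiplier v)
    (C : L2Circle) : ∫⁻ x : ℝ, ‖(v x : ℂ) * C x‖ₑ ^ 2 ≤ ‖C‖ₑ ^ 2 := by
  rw [lintegral_mul_periodic C hv.1, enorm_sq_eq_lintegral, ← lintegral_Ioc_eq_haarAddCircle]
  refine lintegral_mono fun x => mul_le_of_le_one_right' ?_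
  simpa using tsum_enorm_sq_le (hv.2 x)

lemma IsPeriodicMultiplier.memLp {v : ℝ → ℝ} (hv : IsPeriodicMultiplier v) (C : L2Circle) :
    MemLp (fun x : ℝ => (v x : ℂ) * C x) 2 volume := by
  have hC := (Lp.stronglyMeasurable C).measurable.comp (AddCircle.measurable_mk' (a := (1 : ℝ)))
  have hv1 := hv.1
  refine ⟨Measurable.aestronglyMeasurable (by fun_prop), ?_⟩
  have h := eLpNorm_nnreal_pow_eq_lintegral (f := fun x : ℝ => (v x : ℂ) * C x) (μ := volume)
    (p := 2) two_ne_zero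
  have h2 := hv.lintegral_le C
  simp only [NNReal.coe_ofNat, ENNReal.rpow_ofNat, ENNReal.coe_ofNat] at h
  rw [← h] at h2
  have h3 := (ENNReal.pow_le_pow_left_iff two_ne_zero).1 h2
  exact h3.trans_lt enorm_lt_top

/-- The contraction `C ↦ v · C` from `L²` of the circle to `L²(ℝ)`. -/
def IsPeriodicMultiplier.toCLM {v : ℝ → ℝ} (hv : IsPeriodicMultiplier v) : L2Circle →L[ℂ] L2 :=
  LinearMap.mkContinuous
    { toFun := fun C => (hv.memLp C).toLp
      map_add' := fun C D => by
        rw [← MemLp.toLp_add, MemLp.toLp_eq_toLp_iff]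
        filter_upwards [quasiMeasurePreserving_coe_addCircle.ae (Lp.coeFn_add C D)] with x hx
        simp only [hx, Pi.add_apply, mul_add]
      map_smul' := fun c C => by
        rw [← MemLp.toLp_const_smul, MemLp.toLp_eq_toLp_iff]
        filter_upwards [quasiMeasurePreserving_coe_addCircle.ae (Lp.coeFn_smul c C)] with x hx
        simp only [hx, Pi.smul_apply, smul_eq_mul, RingHom.id_apply]
        ring }
    1 fun C => by
      refine norm_le_mul_of_enorm_sq_le zero_le_one ?_
      rw [enorm_sq_eq_lintegral, ENNReal.ofReal_one, one_pow, one_mul]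
      refine le_trans (le_of_eq (lintegral_congr_ae ?_)) (hv.lintegral_le C)
      filter_upwards [(hv.memLp C).coeFn_toLp] with x hx
      exact congrArg (‖·‖ₑ ^ 2) hx

lemma IsPeriodicMultiplier.coeFn_toCLM {v : ℝ → ℝ} (hv : IsPeriodicMultiplier v) (C : L2Circle) :
    hv.toCLM C =ᵐ[volume] fun x : ℝ => (v x : ℂ) * C x :=
  (hv.memLp C).coeFn_toLp

lemma IsPeriodicMultiplier.norm_toCLM_le {v : ℝ → ℝ} (hv : IsPeriodicMultiplier v) :
    ‖hv.toCLM‖ ≤ 1 :=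
  LinearMap.mkContinuous_norm_le _ zero_le_one _

lemma IsPeriodicMultiplier.norm_toCLM_apply_le {v : ℝ → ℝ} (hv : IsPeriodicMultiplier v)
    (C : L2Circle) : ‖hv.toCLM C‖ ≤ ‖C‖ := by
  simpa using hv.toCLM.le_of_opNorm_le hv.norm_toCLM_le C

/-! ### Affine changes of variable and the Fourier transform on `L²(ℝ)`. -/

section affine

variable {a : ℝ} {c : ℝ → ℂ}

lemma map_affine_volume (ha : 0 < a) (b : ℝ) :
    Measure.map (fun x : ℝ => a * x + b) volume = ENNReal.ofReal a⁻¹ • volume := by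
  have h : (fun x : ℝ => a * x + b) = (fun x => x + b) ∘ fun x => a * x := rfl
  rw [h, ← Measure.map_map (by fun_prop) (by fun_prop), Real.map_volume_mul_left ha.ne',
    Measure.map_smul, map_add_right_eq_self, abs_of_pos (by positivity)]

lemma quasiMeasurePreserving_affine (ha : 0 < a) (b : ℝ) :
    Measure.QuasiMeasurePreserving (fun x : ℝ => a * x + b) volume volume :=
  ⟨by fun_prop, by rw [map_affine_volume ha]; exact Measure.smul_absolutelyContinuous⟩

lemma lintegral_affine (ha : 0 < a) (b : ℝ) {f : ℝ → ℝ≥0∞} (hf : Measurable f) :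
    ENNReal.ofReal a * ∫⁻ x, f (a * x + b) = ∫⁻ x, f x := by
  have h := lintegral_map (μ := volume) hf (by fun_prop : Measurable fun x : ℝ => a * x + b)
  rw [← h, map_affine_volume ha, lintegral_smul_measure, smul_eq_mul, ← mul_assoc,
    ← ENNReal.ofReal_mul ha.le, mul_inv_cancel₀ ha.ne', ENNReal.ofReal_one, one_mul]

lemma lintegral_affineMod (ha : 0 < a) (b : ℝ) (hc1 : ∀ x, ‖c x‖ = 1) (φ : L2) :
    ∫⁻ x, ‖((a ^ (1 / 2 : ℝ) : ℝ) : ℂ) * c x * φ (a * x + b)‖ₑ ^ 2 = ‖φ‖ₑ ^ 2 := by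
  have hφ := (Lp.stronglyMeasurable φ).measurable
  rw [enorm_sq_eq_lintegral, ← lintegral_affine ha b (f := fun x => ‖φ x‖ₑ ^ 2) (by fun_prop),
    ← lintegral_const_mul _ (by fun_prop)]
  refine lintegral_congr fun x => ?_
  have h1 : ‖c x‖ₑ = 1 := by rw [← ofReal_norm, hc1, ENNReal.ofReal_one]
  have h2 : ‖((a ^ (1 / 2 : ℝ) : ℝ) : ℂ)‖ₑ ^ 2 = ENNReal.ofReal a := by
    rw [← ofReal_norm, ← ENNReal.ofReal_pow (norm_nonneg _), Complex.norm_real,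
      Real.norm_of_nonneg (by positivity), ← Real.rpow_natCast, ← Real.rpow_mul ha.le]
    norm_num
  rw [enorm_mul, enorm_mul, h1, mul_one, mul_pow, h2]

lemma memLp_affineMod (ha : 0 < a) (b : ℝ) (hc : Measurable c) (hc1 : ∀ x, ‖c x‖ = 1) (φ : L2) :
    MemLp (fun x => ((a ^ (1 / 2 : ℝ) : ℝ) : ℂ) * c x * φ (a * x + b)) 2 volume := by
  have hφ := (Lp.stronglyMeasurable φ).measurable
  refine ⟨Measurable.aestronglyMeasurable (by fun_prop), ?_⟩
  have h := eLpNorm_nnreal_pow_eq_lintegral (μ := volume) (p := 2) two_ne_zero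
    (f := fun x => ((a ^ (1 / 2 : ℝ) : ℝ) : ℂ) * c x * φ (a * x + b))
  simp only [NNReal.coe_ofNat, ENNReal.rpow_ofNat, ENNReal.coe_ofNat] at h
  rw [lintegral_affineMod ha b hc1] at h
  exact ((ENNReal.pow_le_pow_left_iff two_ne_zero).1 h.le).trans_lt enorm_lt_top

/-- The isometry `φ ↦ √a c(x) φ(a x + b)` of `L²(ℝ)`, where `|c| = 1`. -/
def affineMod (ha : 0 < a) (b : ℝ) (hc : Measurable c) (hc1 : ∀ x, ‖c x‖ = 1) : L2 →ₗᵢ[ℂ] L2 where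
  toFun φ := (memLp_affineMod ha b hc hc1 φ).toLp
  map_add' φ ψ := by
    rw [← MemLp.toLp_add, MemLp.toLp_eq_toLp_iff]
    filter_upwards [(quasiMeasurePreserving_affine ha b).ae (Lp.coeFn_add φ ψ)] with x hx
    simp only [hx, Pi.add_apply, mul_add]
  map_smul' t φ := by
    rw [← MemLp.toLp_const_smul, MemLp.toLp_eq_toLp_iff]
    filter_upwards [(quasiMeasurePreserving_affine ha b).ae (Lp.coeFn_smul t φ)] with x hx
    simp only [hx, Pi.smul_apply, smul_eq_mul, RingHom.id_apply]
    ring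
  norm_map' φ := by
    have h : ‖(memLp_affineMod ha b hc hc1 φ).toLp‖ₑ ^ 2 = ‖φ‖ₑ ^ 2 := by
      rw [enorm_sq_eq_lintegral, ← lintegral_affineMod ha b hc1]
      refine lintegral_congr_ae ?_
      filter_upwards [(memLp_affineMod ha b hc hc1 φ).coeFn_toLp] with x hx
      exact congrArg (‖·‖ₑ ^ 2) hx
    have h2 := congrArg ENNReal.toReal h
    rw [ENNReal.toReal_pow, ENNReal.toReal_pow, toReal_enorm, toReal_enorm] at h2
    exact (pow_left_inj₀ (norm_nonneg _) (norm_nonneg _) two_ne_zero).1 h2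

lemma coeFn_affineMod (ha : 0 < a) (b : ℝ) (hc : Measurable c) (hc1 : ∀ x, ‖c x‖ = 1) (φ : L2) :
    affineMod ha b hc hc1 φ =ᵐ[volume]
      fun x => ((a ^ (1 / 2 : ℝ) : ℝ) : ℂ) * c x * φ (a * x + b) :=
  (memLp_affineMod ha b hc hc1 φ).coeFn_toLp

/-- Composition of a Schwartz function with `x ↦ a x + b`. -/
def schwartzAffine (ha : 0 < a) (b : ℝ) (f : 𝓢(ℝ, ℂ)) : 𝓢(ℝ, ℂ) :=
  SchwartzMap.compCLMOfContinuousLinearEquiv ℂ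
    (ContinuousLinearEquiv.smulLeft (Units.mk0 a ha.ne') : ℝ ≃L[ℝ] ℝ)
    (f.compSubConstCLM ℂ (-b))

lemma schwartzAffine_apply (ha : 0 < a) (b : ℝ) (f : 𝓢(ℝ, ℂ)) (x : ℝ) :
    schwartzAffine ha b f x = f (a * x + b) := by
  change f (a * x - -b) = _
  rw [sub_neg_eq_add]

lemma fourier_affine (ha : 0 < a) (b : ℝ) (f : ℝ → ℂ) (γ : ℝ) :
    𝓕 (fun x => f (a * x + b)) γ =
      ((a⁻¹ : ℝ) : ℂ) * Complex.exp (↑(2 * Real.pi * (b * γ / a)) * Complex.I) *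
        𝓕 f (γ / a) := by
  rw [Real.fourier_eq', Real.fourier_eq']
  have h1 := Measure.integral_comp_mul_left (fun y => Complex.exp
    (↑(2 * Real.pi * (b * γ / a)) * Complex.I) * (Complex.exp
    (↑(-2 * Real.pi * inner ℝ (y + b) (γ / a)) * Complex.I) • f (y + b))) a
  have h2 := integral_add_right_eq_self (μ := volume) (fun y => Complex.exp
    (↑(2 * Real.pi * (b * γ / a)) * Complex.I) * (Complex.exp
    (↑(-2 * Real.pi * inner ℝ y (γ / a)) * Complex.I) • f y)) b
  rw [h2, abs_of_pos (by positivity)] at h1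
  rw [mul_assoc, ← Complex.real_smul, ← integral_const_mul, ← h1]
  refine integral_congr_ae (Eventually.of_forall fun x => ?_)
  simp only [smul_eq_mul]
  rw [← mul_assoc, ← Complex.exp_add, ← add_mul, ← Complex.ofReal_add]
  congr 4
  simp only [RCLike.inner_apply, conj_trivial]
  field_simp
  ring

/-- The modulation that corresponds to a translation under the Fourier transform. -/
def modulation (a b γ : ℝ) : ℂ := Complex.exp (↑(2 * Real.pi * (b * γ / a)) * Complex.I)

lemma measurable_modulation (a b : ℝ) : Measurable (modulation a b) := by
  unfold modulation; fun_prop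

lemma norm_modulation (a b γ : ℝ) : ‖modulation a b γ‖ = 1 := Complex.norm_exp_ofReal_mul_I _

/-- Both sides are continuous in `φ`, so it is enough to check Schwartz functions, where the
integral formula `fourier_affine` applies. -/
lemma fourier_affineMod (ha : 0 < a) (b : ℝ) (φ : L2) :
    𝓕 (affineMod ha b (c := 1) measurable_one (by simp) φ) =
      affineMod (inv_pos.2 ha) 0 (measurable_modulation a b) (norm_modulation a b) (𝓕 φ) := by
  refine (SchwartzMap.denseRange_toLpCLM (p := 2) (F := ℂ) (μ := (volume : Measure ℝ))
    ENNReal.ofNat_ne_top).induction_on (p := fun φ : L2 =>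
    𝓕 (affineMod ha b (c := 1) measurable_one (by simp) φ) =
      affineMod (inv_pos.2 ha) 0 (measurable_modulation a b) (norm_modulation a b) (𝓕 φ))
    φ ?_ fun f => ?_
  · exact isClosed_eq ((Lp.fourierTransformₗᵢ ℝ ℂ).continuous.comp (affineMod ha b _ _).continuous)
      ((affineMod (inv_pos.2 ha) 0 _ _).continuous.comp (Lp.fourierTransformₗᵢ ℝ ℂ).continuous)
  · change 𝓕 (affineMod ha b (c := 1) measurable_one (by simp) (f.toLp 2 volume)) =
      affineMod (inv_pos.2 ha) 0 (measurable_modulation a b) (norm_modulation a b) (𝓕 (f.toLp 2 volume))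
    have e1 : affineMod ha b (c := 1) measurable_one (by simp) (f.toLp 2 volume) =
        ((a ^ (1 / 2 : ℝ) : ℝ) : ℂ) • (schwartzAffine ha b f).toLp 2 volume := by
      refine Lp.ext ?_
      filter_upwards [coeFn_affineMod ha b (c := 1) measurable_one (by simp) (f.toLp 2 volume),
        (quasiMeasurePreserving_affine ha b).ae (f.coeFn_toLp 2 volume),
        (schwartzAffine ha b f).coeFn_toLp 2 volume, Lp.coeFn_smul ((a ^ (1 / 2 : ℝ) : ℝ) : ℂ)
        ((schwartzAffine ha b f).toLp 2 volume)] with x h1 h2 h3 h4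
      rw [h1, h2, h4, Pi.smul_apply, h3, schwartzAffine_apply]
      simp
    rw [e1, FourierTransform.fourier_smul, SchwartzMap.toLp_fourier_eq,
      SchwartzMap.toLp_fourier_eq]
    refine Lp.ext ?_
    filter_upwards [coeFn_affineMod (inv_pos.2 ha) 0 (measurable_modulation a b)
      (norm_modulation a b) ((𝓕 f).toLp 2 volume),
      (quasiMeasurePreserving_affine (inv_pos.2 ha) 0).ae ((𝓕 f).coeFn_toLp 2 volume),
      (𝓕 (schwartzAffine ha b f)).coeFn_toLp 2 volume, Lp.coeFn_smul ((a ^ (1 / 2 : ℝ) : ℝ) : ℂ)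
      ((𝓕 (schwartzAffine ha b f)).toLp 2 volume)] with x h1 h2 h3 h4
    rw [h1, h2, h4, Pi.smul_apply, h3, SchwartzMap.fourier_coe, SchwartzMap.fourier_coe,
      funext (schwartzAffine_apply ha b f), fourier_affine ha, add_zero, smul_eq_mul,
      ← mul_assoc, ← mul_assoc, ← Complex.ofReal_mul, modulation, mul_comm a⁻¹ x, div_eq_mul_inv]
    congr 3
    rw [Real.inv_rpow ha.le, ← Real.rpow_neg ha.le, ← Real.rpow_neg_one a,
      ← Real.rpow_add ha]
    norm_num

end affine

/-! ### How far `M M*` is from the identity at low frequency. -/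

lemma norm_sub_apply_adjoint_le_two_mul {H G : Type*} [NormedAddCommGroup H]
    [InnerProductSpace ℂ H] [CompleteSpace H] [NormedAddCommGroup G] [InnerProductSpace ℂ G]
    [CompleteSpace G] (M : G →L[ℂ] H) (hM : ‖M‖ ≤ 1) (r : H) :
    ‖r - M (M.adjoint r)‖ ≤ 2 * ‖r‖ := by
  have h1 : ‖M (M.adjoint r)‖ ≤ ‖r‖ := by
    have h2 := M.le_of_opNorm_le hM (M.adjoint r)
    have h3 := M.adjoint.le_of_opNorm_le
      ((LinearIsometryEquiv.norm_map ContinuousLinearMap.adjoint M).trans_le hM) r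
    linarith
  linarith [norm_sub_le r (M (M.adjoint r))]

/-- The indicator function of the unit interval centred at `0`. -/
def unitIndicator : ℝ → ℝ := (Set.Ioc (-1 / 2 : ℝ) (1 / 2)).indicator 1

lemma unitIndicator_of_mem {x : ℝ} (hx : x ∈ Set.Ioc (-1 / 2 : ℝ) (1 / 2)) :
    unitIndicator x = 1 := Set.indicator_of_mem hx _

lemma unitIndicator_of_notMem {x : ℝ} (hx : x ∉ Set.Ioc (-1 / 2 : ℝ) (1 / 2)) :
    unitIndicator x = 0 := Set.indicator_of_notMem hx _

lemma unitIndicator_add_int {x : ℝ} (hx : x ∈ Set.Ioc (-1 / 2 : ℝ) (1 / 2)) {k : ℤ} (hk : k ≠ 0) :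
    unitIndicator (x + k) = 0 := by
  refine unitIndicator_of_notMem fun h => hk ?_
  have h1 : (k : ℝ) < 1 := by linarith [h.2, hx.1]
  have h2 : (-1 : ℝ) < k := by linarith [h.1, hx.2]
  have h3 : k < 1 := by exact_mod_cast h1
  have h4 : -1 < k := by exact_mod_cast h2
  omega

lemma isPeriodicMultiplier_unitIndicator : IsPeriodicMultiplier unitIndicator := by
  refine ⟨measurable_one.indicator measurableSet_Ioc, fun x s => ?_⟩
  by_cases h : ∃ j ∈ s, x + j ∈ Set.Ioc (-1 / 2 : ℝ) (1 / 2)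
  · obtain ⟨j, hj, hx⟩ := h
    rw [Finset.sum_eq_single_of_mem j hj fun k _ hk => ?_, unitIndicator_of_mem hx, one_pow]
    have := unitIndicator_add_int hx (sub_ne_zero.2 hk)
    rw [Int.cast_sub, add_add_sub_cancel] at this
    rw [this, zero_pow two_ne_zero]
  · push Not at h
    rw [Finset.sum_eq_zero fun j hj => ?_]
    · exact zero_le_one
    · rw [unitIndicator_of_notMem (h j hj), zero_pow two_ne_zero]

/-- The isometric extension by zero from the circle to the line. -/
def extendZero : L2Circle →ₗᵢ[ℂ] L2 where
  toLinearMap := isPeriodicMultiplier_unitIndicator.toCLM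
  norm_map' C := by
    refine le_antisymm (isPeriodicMultiplier_unitIndicator.norm_toCLM_apply_le C) ?_
    refine (norm_le_mul_of_enorm_sq_le (y := isPeriodicMultiplier_unitIndicator.toCLM C)
      zero_le_one ?_).trans_eq (one_mul _)
    rw [ENNReal.ofReal_one, one_pow, one_mul]
    have h1 : ‖isPeriodicMultiplier_unitIndicator.toCLM C‖ₑ ^ 2 =
        ∫⁻ x : ℝ, ‖(unitIndicator x : ℂ) * C x‖ₑ ^ 2 := by
      rw [enorm_sq_eq_lintegral]
      refine lintegral_congr_ae ?_
      filter_upwards [isPeriodicMultiplier_unitIndicator.coeFn_toCLM C] with x hx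
      exact congrArg (‖·‖ₑ ^ 2) hx
    refine le_of_le_of_eq ?_ h1.symm
    rw [lintegral_mul_periodic C isPeriodicMultiplier_unitIndicator.1, enorm_sq_eq_lintegral,
      ← lintegral_Ioc_eq_haarAddCircle]
    refine setLIntegral_mono' measurableSet_Ioc fun x hx => le_mul_of_one_le_right' ?_
    refine le_trans (le_of_eq ?_) (ENNReal.le_tsum (0 : ℤ))
    rw [Int.cast_zero, add_zero, unitIndicator_of_mem hx, enorm_one, one_pow]

lemma coeFn_extendZero (C : L2Circle) :
    extendZero C =ᵐ[volume] fun x : ℝ => (unitIndicator x : ℂ) * C x :=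
  isPeriodicMultiplier_unitIndicator.coeFn_toCLM C

lemma exists_periodization (h : L2) :
    ∃ F : L2Circle, ∀ᵐ x : ℝ, x ∈ Set.Ioc (-1 / 2 : ℝ) (1 / 2) → F x = h x := by
  have hI : Set.Ioc (-1 / 2 : ℝ) (1 / 2) = Set.Ioc (-1 / 2 : ℝ) (-1 / 2 + 1) := by norm_num
  have h1 : MemLp (AddCircle.liftIoc 1 (-1 / 2) h) 2
      (AddCircle.haarAddCircle : Measure UnitAddCircle) :=
    memLp_haarAddCircle_iff.2 ((Lp.memLp h).restrict _).memLp_liftIoc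
  refine ⟨h1.toLp, ?_⟩
  filter_upwards [quasiMeasurePreserving_coe_addCircle.ae h1.coeFn_toLp] with x hx hxI
  rw [hx]
  exact AddCircle.liftIoc_coe_apply (hI ▸ hxI)

section estimate

variable {v : ℝ → ℝ} (hv : IsPeriodicMultiplier v) {β K : ℝ}

lemma norm_extendZero_sub_le (hK : 0 ≤ K)
    (hvK : ∀ x ∈ Set.Ioc (-1 / 2 : ℝ) (1 / 2), ∀ s : Finset ℤ,
      ∑ k ∈ s, (unitIndicator (x + k) - v (x + k)) ^ 2 ≤ (K * |x| ^ β) ^ 2)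
    {F : L2Circle} {w : L2}
    (hF : ∀ᵐ x : ℝ, x ∈ Set.Ioc (-1 / 2 : ℝ) (1 / 2) → |x| ^ β * ‖F x‖ ≤ ‖w x‖) :
    ‖extendZero F - hv.toCLM F‖ ≤ K * ‖w‖ := by
  refine norm_le_mul_of_enorm_sq_le hK ?_
  have hm : Measurable fun x => unitIndicator x - v x :=
    isPeriodicMultiplier_unitIndicator.1.sub hv.1
  have h1 : ‖extendZero F - hv.toCLM F‖ₑ ^ 2 =
      ∫⁻ x : ℝ, ‖((unitIndicator x - v x : ℝ) : ℂ) * F x‖ₑ ^ 2 := by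
    rw [enorm_sq_eq_lintegral]
    refine lintegral_congr_ae ?_
    filter_upwards [coeFn_extendZero F, hv.coeFn_toCLM F,
      Lp.coeFn_sub (extendZero F) (hv.toCLM F)] with x h1 h2 h3
    rw [h3, Pi.sub_apply, h1, h2, Complex.ofReal_sub, sub_mul]
  rw [h1, lintegral_mul_periodic F hm, enorm_sq_eq_lintegral w, ← lintegral_const_mul' _ _
    (by finiteness)]
  refine (lintegral_mono_ae ?_).trans (setLIntegral_le_lintegral _ _)
  rw [ae_restrict_iff' measurableSet_Ioc]
  filter_upwards [hF] with x hx hxI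
  have h2 := mul_le_mul_right (tsum_enorm_sq_le (hvK x hxI)) (‖F x‖ₑ ^ 2)
  refine h2.trans ?_
  have h3 : 0 ≤ K * |x| ^ β := by positivity
  rw [← mul_pow, ENNReal.ofReal_pow h3, ← mul_pow, ← ofReal_norm, ← ofReal_norm,
    ← ENNReal.ofReal_mul (norm_nonneg _), ← ENNReal.ofReal_mul hK]
  refine pow_le_pow_left' (ENNReal.ofReal_le_ofReal ?_) 2
  have := mul_le_mul_of_nonneg_left (hx hxI) hK
  linarith

/-- With `E = extendZero` and `D = F - M* E F`, duality gives `⟪D, D⟫ = ⟪E F, (E - M) D⟫ = ⟪(1 - v)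
E F, E D⟫`, as `E F` lives on the unit interval and `v` is real. Cauchy–Schwarz finishes, with no
explicit formula for `M*`. -/
lemma norm_sub_adjoint_extendZero_le (hK : 0 ≤ K)
    (hvK : ∀ x ∈ Set.Ioc (-1 / 2 : ℝ) (1 / 2), |1 - v x| ≤ K * |x| ^ β)
    {F : L2Circle} {w : L2}
    (hF : ∀ᵐ x : ℝ, x ∈ Set.Ioc (-1 / 2 : ℝ) (1 / 2) → |x| ^ β * ‖F x‖ ≤ ‖w x‖) :
    ‖F - hv.toCLM.adjoint (extendZero F)‖ ≤ K * ‖w‖ := by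
  set D := F - hv.toCLM.adjoint (extendZero F) with hD
  have hbound : ∀ᵐ x : ℝ, ‖((1 - v x : ℝ) : ℂ) * extendZero F x‖ ≤ K * ‖w x‖ := by
    filter_upwards [hF, coeFn_extendZero F] with x hx h1
    rw [h1]
    by_cases hxI : x ∈ Set.Ioc (-1 / 2 : ℝ) (1 / 2)
    · rw [unitIndicator_of_mem hxI, Complex.ofReal_one, one_mul, norm_mul, Complex.norm_real,
        Real.norm_eq_abs]
      have h2 := mul_le_mul_of_nonneg_right (hvK x hxI) (norm_nonneg (F x))
      have h3 := mul_le_mul_of_nonneg_left (hx hxI) hK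
      linarith
    · rw [unitIndicator_of_notMem hxI, Complex.ofReal_zero, zero_mul, mul_zero, norm_zero]
      positivity
  have hmem : MemLp (fun x => ((1 - v x : ℝ) : ℂ) * extendZero F x) 2 volume := by
    refine (Lp.memLp w).of_le_mul (Measurable.aestronglyMeasurable ?_) hbound
    have h1 := (Lp.stronglyMeasurable (extendZero F)).measurable
    have h2 := hv.1
    fun_prop
  have hp : ‖hmem.toLp‖ ≤ K * ‖w‖ := by
    refine Lp.norm_le_mul_norm_of_ae_le_mul ?_
    filter_upwards [hbound, hmem.coeFn_toLp] with x h1 h2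
    rwa [h2]
  have hinner : ⟪D, D⟫_ℂ = ⟪hmem.toLp, extendZero D⟫_ℂ := by
    have e1 : ⟪D, D⟫_ℂ = ⟪extendZero F, extendZero D⟫_ℂ - ⟪extendZero F, hv.toCLM D⟫_ℂ := by
      rw [extendZero.inner_map_map, ← ContinuousLinearMap.adjoint_inner_left, ← inner_sub_left,
        ← hD]
    rw [e1, ← inner_sub_right, L2.inner_def, L2.inner_def]
    refine integral_congr_ae ?_
    filter_upwards [coeFn_extendZero F, coeFn_extendZero D, hv.coeFn_toCLM D, hmem.coeFn_toLp,
      Lp.coeFn_sub (extendZero D) (hv.toCLM D)] with x h1 h2 h3 h4 h5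
    rw [h5, Pi.sub_apply, h4, h1, h2, h3]
    simp only [RCLike.inner_apply, map_mul, Complex.conj_ofReal]
    by_cases hxI : x ∈ Set.Ioc (-1 / 2 : ℝ) (1 / 2)
    · rw [unitIndicator_of_mem hxI]
      push_cast
      ring
    · rw [unitIndicator_of_notMem hxI]
      push_cast
      ring
  have h1 : ‖D‖ * ‖D‖ ≤ K * ‖w‖ * ‖D‖ := by
    rw [← inner_self_eq_norm_mul_norm (𝕜 := ℂ), hinner]
    refine (RCLike.re_le_norm _).trans ((norm_inner_le_norm _ _).trans ?_)
    rw [extendZero.norm_map]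
    exact mul_le_mul_of_nonneg_right hp (norm_nonneg _)
  rcases (norm_nonneg D).eq_or_lt with h0 | h0
  · rw [← h0]
    positivity
  · exact le_of_mul_le_mul_right h1 h0

lemma norm_sub_apply_adjoint_le (hβ : 0 ≤ β) (hK : 0 ≤ K)
    (hvK : ∀ x ∈ Set.Ioc (-1 / 2 : ℝ) (1 / 2), ∀ s : Finset ℤ,
      ∑ k ∈ s, (unitIndicator (x + k) - v (x + k)) ^ 2 ≤ (K * |x| ^ β) ^ 2)
    {h w : L2} (hw : ∀ᵐ x : ℝ, |x| ^ β * ‖h x‖ ≤ ‖w x‖) :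
    ‖h - hv.toCLM (hv.toCLM.adjoint h)‖ ≤ (2 * K + 2 * 2 ^ β) * ‖w‖ := by
  obtain ⟨F, hFh⟩ := exists_periodization h
  have hF : ∀ᵐ x : ℝ, x ∈ Set.Ioc (-1 / 2 : ℝ) (1 / 2) → |x| ^ β * ‖F x‖ ≤ ‖w x‖ := by
    filter_upwards [hFh, hw] with x h1 h2 hx
    rwa [h1 hx]
  have hv1 : ∀ x ∈ Set.Ioc (-1 / 2 : ℝ) (1 / 2), |1 - v x| ≤ K * |x| ^ β := fun x hx => by
    have h1 := hvK x hx {0}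
    rw [Finset.sum_singleton, Int.cast_zero, add_zero, unitIndicator_of_mem hx] at h1
    exact abs_le_of_sq_le_sq h1 (by positivity)
  have a1 := norm_extendZero_sub_le hv hK hvK hF
  have a2 := norm_sub_adjoint_extendZero_le hv hK hv1 hF
  have a3 : ‖h - extendZero F‖ ≤ 2 ^ β * ‖w‖ := by
    refine Lp.norm_le_mul_norm_of_ae_le_mul ?_
    filter_upwards [hFh, hw, coeFn_extendZero F, Lp.coeFn_sub h (extendZero F)] with x h1 h2 h3 h4
    rw [h4, Pi.sub_apply, h3]
    by_cases hxI : x ∈ Set.Ioc (-1 / 2 : ℝ) (1 / 2)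
    · rw [unitIndicator_of_mem hxI, h1 hxI, Complex.ofReal_one, one_mul, sub_self, norm_zero]
      positivity
    · rw [unitIndicator_of_notMem hxI, Complex.ofReal_zero, zero_mul, sub_zero]
      have h5 : 1 / 2 ≤ |x| := by
        by_contra! h6
        rw [abs_lt] at h6
        exact hxI ⟨by linarith [h6.1], h6.2.le⟩
      -- Off the unit interval `2 * |x| ≥ 1`, so the weight alone controls the high frequencies.
      have h7 : (1 : ℝ) ≤ 2 ^ β * |x| ^ β := by
        rw [← Real.mul_rpow zero_le_two (abs_nonneg x)]
        exact Real.one_le_rpow (by linarith) hβ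
      have h8 : (0 : ℝ) ≤ 2 ^ β := by positivity
      have h9 := mul_le_mul_of_nonneg_left h2 h8
      nlinarith [norm_nonneg (h x), mul_le_mul_of_nonneg_right h7 (norm_nonneg (h x))]
  have a4 := norm_sub_apply_adjoint_le_two_mul hv.toCLM hv.norm_toCLM_le (h - extendZero F)
  have a5 := hv.norm_toCLM_apply_le (F - hv.toCLM.adjoint (extendZero F))
  -- High frequencies, plus the error of replacing `E` by `M` in synthesis, plus the error of
  -- replacing `E*` by `M*` in analysis.
  have e : h - hv.toCLM (hv.toCLM.adjoint h) =
      ((h - extendZero F) - hv.toCLM (hv.toCLM.adjoint (h - extendZero F))) +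
      ((extendZero F - hv.toCLM F) + hv.toCLM (F - hv.toCLM.adjoint (extendZero F))) := by
    simp only [map_sub]
    abel
  rw [e]
  refine (norm_add_le _ _).trans ?_
  have a6 := norm_add_le (extendZero F - hv.toCLM F)
    (hv.toCLM (F - hv.toCLM.adjoint (extendZero F)))
  linarith

end estimate

/-! ### The operators `𝒫ₙ` on the Fourier side. -/

/-- Apply `S` to the Fourier expansion of `S* u`. The index is negated because translation by `k`
becomes modulation with frequency `-k`. -/
lemma hasSum_inner_smul_apply_fourierLp {H : Type*} [NormedAddCommGroup H]
    [InnerProductSpace ℂ H] [CompleteSpace H] (S : L2Circle →L[ℂ] H) (u : H) :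
    HasSum (fun k : ℤ => ⟪S (fourierLp 2 (-k)), u⟫_ℂ • S (fourierLp 2 (-k))) (S (S.adjoint u)) := by
  have h := ((fourierBasis (T := 1)).hasSum_repr (S.adjoint u)).mapL S
  rw [← (Equiv.neg ℤ).hasSum_iff] at h
  refine h.congr_fun fun k => ?_
  simp only [Function.comp, Equiv.neg_apply, HilbertBasis.repr_apply_apply, map_smul,
    coe_fourierBasis, ContinuousLinearMap.adjoint_inner_right]

lemma two_zpow_pos (n : ℤ) : (0 : ℝ) < 2 ^ n := by positivity

/-- The dilation `Dⁿ` of `L²(ℝ)`. -/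
def dilation (n : ℤ) : L2 →ₗᵢ[ℂ] L2 :=
  affineMod (two_zpow_pos n) 0 (c := 1) measurable_one (by simp)

lemma two_zpow_rpow_half (n : ℤ) : ((2 : ℝ) ^ n) ^ (1 / 2 : ℝ) = 2 ^ ((n : ℝ) / 2) := by
  rw [← Real.rpow_intCast, ← Real.rpow_mul zero_le_two, mul_one_div]

lemma coeFn_dilation (n : ℤ) (h : L2) :
    dilation n h =ᵐ[volume] fun x => ((2 ^ ((n : ℝ) / 2) : ℝ) : ℂ) * h (2 ^ n * x) := by
  filter_upwards [coeFn_affineMod (two_zpow_pos n) 0 (c := 1) measurable_one (by simp) h] with x hx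
  rw [dilation, hx, two_zpow_rpow_half]
  simp

lemma dilation_dilation_neg (n : ℤ) (h : L2) : dilation n (dilation (-n) h) = h := by
  refine Lp.ext ?_
  filter_upwards [coeFn_dilation n (dilation (-n) h),
    (quasiMeasurePreserving_affine (two_zpow_pos n) 0).ae (coeFn_dilation (-n) h)] with x h1 h2
  simp only [add_zero] at h2
  rw [h1, h2, ← mul_assoc, ← mul_assoc, ← Complex.ofReal_mul, ← Real.rpow_add two_pos, zpow_neg,
    inv_mul_cancel₀ (two_zpow_pos n).ne']
  simp [neg_div]

lemma dilateTranslate_eq_affineMod (φ : L2) (n k : ℤ) : dilateTranslate φ n k =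
    affineMod (two_zpow_pos n) (-k) (c := 1) measurable_one (by simp) φ := by
  refine Lp.ext ?_
  filter_upwards [(memLp_dilate_translate φ n k).coeFn_toLp,
    coeFn_affineMod (two_zpow_pos n) (-k) (c := 1) measurable_one (by simp) φ] with x h1 h2
  rw [dilateTranslate, h1, h2, two_zpow_rpow_half]
  simp [sub_eq_add_neg]

lemma fourier_dilateTranslate {v : ℝ → ℝ} (hv : IsPeriodicMultiplier v) {φ : L2}
    (hφ : (𝓕 φ : L2) =ᵐ[volume] fun x => (v x : ℂ)) (n k : ℤ) :
    𝓕 (dilateTranslate φ n k) = dilation (-n) (hv.toCLM (fourierLp 2 (-k))) := by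
  rw [dilateTranslate_eq_affineMod, fourier_affineMod]
  refine Lp.ext ?_
  have hq := quasiMeasurePreserving_affine (inv_pos.2 (two_zpow_pos n)) 0
  filter_upwards [coeFn_affineMod (inv_pos.2 (two_zpow_pos n)) 0
    (measurable_modulation (2 ^ n) (-k)) (norm_modulation (2 ^ n) (-k)) (𝓕 φ : L2), hq.ae hφ,
    coeFn_dilation (-n) (hv.toCLM (fourierLp 2 (-k))),
    hq.ae (hv.coeFn_toCLM (fourierLp 2 (-k))),
    hq.ae (quasiMeasurePreserving_coe_addCircle.ae (coeFn_fourierLp 2 (-k)))]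
    with x h1 h2 h3 h4 h5
  simp only [add_zero] at h2 h4 h5
  rw [h1, add_zero, h2, h3, zpow_neg, h4, h5, fourier_coe_apply, ← zpow_neg, two_zpow_rpow_half,
    modulation, mul_assoc, mul_comm (Complex.exp _)]
  congr 3
  push_cast
  rw [zpow_neg]
  field_simp

section

variable {v : ℝ → ℝ} (hv : IsPeriodicMultiplier v) {φ : L2}
/-- The synthesis operator of the system `(DⁿT_kφ)_k`, on the Fourier side. -/
def synthesis (n : ℤ) : L2Circle →L[ℂ] L2 :=
  (dilation (-n)).toContinuousLinearMap ∘L hv.toCLM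

lemma hasSum_projTerm (hφ : (𝓕 φ : L2) =ᵐ[volume] fun x => (v x : ℂ)) (n : ℤ) (f : L2) :
    HasSum (projTerm φ n f) (𝓕⁻ (synthesis hv n ((synthesis hv n).adjoint (𝓕 f)))) := by
  have h := (hasSum_inner_smul_apply_fourierLp (synthesis hv n) (𝓕 f)).mapL
    (Lp.fourierTransformₗᵢ ℝ ℂ).symm.toContinuousLinearEquiv.toContinuousLinearMap
  refine h.congr_fun fun k => ?_
  have e : synthesis hv n (fourierLp 2 (-k)) = 𝓕 (dilateTranslate φ n k) :=
    (fourier_dilateTranslate hv hφ n k).symm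
  rw [e, Lp.inner_fourier_eq, map_smul]
  exact congrArg _ ((Lp.fourierTransformₗᵢ ℝ ℂ).symm_apply_apply (dilateTranslate φ n k)).symm

/-- `synthesis` is `D⁻ⁿ M`, and `D⁻ⁿ` is an isometry with right inverse `Dⁿ`, so the dilation can be
moved onto `𝓕 f`. -/
lemma norm_sub_proj (hφ : (𝓕 φ : L2) =ᵐ[volume] fun x => (v x : ℂ)) (n : ℤ) (f : L2) :
    ‖f - proj φ n f‖ =
      ‖dilation n (𝓕 f) - hv.toCLM (hv.toCLM.adjoint (dilation n (𝓕 f)))‖ := by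
  set h := dilation n (𝓕 f)
  have e1 : (𝓕 f : L2) = dilation (-n) h := by
    have := dilation_dilation_neg (-n) (𝓕 f)
    rw [neg_neg] at this
    exact this.symm
  have e2 : (synthesis hv n).adjoint (dilation (-n) h) = hv.toCLM.adjoint h := by
    refine ext_inner_right ℂ fun D => ?_
    rw [ContinuousLinearMap.adjoint_inner_left, ContinuousLinearMap.adjoint_inner_left]
    exact (dilation (-n)).inner_map_map _ _
  have e3 (z : L2) : 𝓕 (f - 𝓕⁻ z) = 𝓕 f - z :=
    ((Lp.fourierTransformₗᵢ ℝ ℂ).map_sub f _).trans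
      (congrArg (𝓕 f - ·) ((Lp.fourierTransformₗᵢ ℝ ℂ).apply_symm_apply z))
  rw [proj, (hasSum_projTerm hv hφ n f).tsum_eq, ← Lp.norm_fourier_eq, e3, e1, e2]
  exact ((congrArg norm ((dilation (-n)).map_sub _ _)).symm).trans ((dilation (-n)).norm_map _)

end

/-! ### Sobolev regularity and the approximation rate. -/

lemma exists_rpow_mul_norm_fourier_le {β : ℝ} (hβ : 0 ≤ β) {f : L2} (hf : InSobolev β f) :
    ∃ g : L2, ∀ᵐ x : ℝ, |x| ^ β * ‖(𝓕 f : L2) x‖ ≤ ‖g x‖ := by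
  obtain ⟨g, hg⟩ := TemperedDistribution.memSobolev_iff_exists_smulLeftCLM_fourier.1 hf
  have ht (s : ℝ) : (fun x : ℝ => (((1 + ‖x‖ ^ 2) ^ s : ℝ) : ℂ)).HasTemperateGrowth := by fun_prop
  have hbd (x : ℝ) : ‖(((1 + ‖x‖ ^ 2) ^ (-(β / 2)) : ℝ) : ℂ)‖ ≤ 1 := by
    rw [Complex.norm_real, Real.norm_of_nonneg (by positivity)]
    exact Real.rpow_le_one_of_one_le_of_nonpos (by nlinarith [sq_nonneg ‖x‖]) (by linarith)
  have hm : MemLp (fun x : ℝ => (((1 + ‖x‖ ^ 2) ^ (-(β / 2)) : ℝ) : ℂ)) ∞ volume :=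
    memLp_top_of_bound (ht _).1.continuous.aestronglyMeasurable 1 (Eventually.of_forall hbd)
  have e1 := Lp.toTemperedDistribution_smul_eq (r := 2) (ht (-(β / 2))) hm g
  rw [← hg, TemperedDistribution.smulLeftCLM_smulLeftCLM_apply (ht _) (ht _)] at e1
  have e2 : (fun x : ℝ => (((1 + ‖x‖ ^ 2) ^ (β / 2) : ℝ) : ℂ)) *
      (fun x : ℝ => (((1 + ‖x‖ ^ 2) ^ (-(β / 2)) : ℝ) : ℂ)) = fun _ => 1 := by
    funext x
    simp only [Pi.mul_apply]
    rw [← Complex.ofReal_mul, ← Real.rpow_add (by positivity), add_neg_cancel, Real.rpow_zero,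
      Complex.ofReal_one]
  rw [e2, TemperedDistribution.smulLeftCLM_const, one_smul,
    Lp.fourier_toTemperedDistribution_eq] at e1
  -- `g` is `(1 + x²) ^ (β / 2)` times `𝓕 f` as a distribution. Multiplying by the bounded inverse
  -- weight returns to `L²`, and injectivity of `L²` into tempered distributions makes the identity
  -- hold almost everywhere.
  have e3 : hm.toLp • g = (𝓕 f : L2) := by
    have := LinearMap.ker_eq_bot.1 (Lp.ker_toTemperedDistributionCLM_eq_bot (F := ℂ)
      (μ := (volume : Measure ℝ)) (p := 2))
    exact this e1
  refine ⟨g, ?_⟩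
  filter_upwards [Lp.coeFn_lpSMul (r := 2) hm.toLp g, hm.coeFn_toLp] with x h1 h2
  rw [← e3, h1, Pi.smul_apply', h2, smul_eq_mul, norm_mul, ← mul_assoc, Complex.norm_real,
    Real.norm_of_nonneg (by positivity)]
  refine mul_le_of_le_one_left (norm_nonneg _) ?_
  have h3 : |x| ^ β ≤ (1 + ‖x‖ ^ 2) ^ (β / 2) := by
    rw [Real.norm_eq_abs, show |x| ^ β = (|x| ^ 2) ^ (β / 2) by
      rw [← Real.rpow_natCast, ← Real.rpow_mul (abs_nonneg x)]; congr 1; push_cast; ring]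
    exact Real.rpow_le_rpow (sq_nonneg _) (by linarith) (by linarith)
  refine (mul_le_mul_of_nonneg_right h3 (by positivity)).trans_eq ?_
  rw [← Real.rpow_add (by positivity), add_neg_cancel, Real.rpow_zero]

lemma providesApproximationOrder_proj {v : ℝ → ℝ} (hv : IsPeriodicMultiplier v) {φ : L2}
    (hφ : (𝓕 φ : L2) =ᵐ[volume] fun x => (v x : ℂ)) {β K : ℝ} (hβ : 0 ≤ β) (hK : 0 ≤ K)
    (hvK : ∀ x ∈ Set.Ioc (-1 / 2 : ℝ) (1 / 2), ∀ s : Finset ℤ,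
      ∑ k ∈ s, (unitIndicator (x + k) - v (x + k)) ^ 2 ≤ (K * |x| ^ β) ^ 2) :
    ProvidesApproximationOrder (proj φ) β := by
  intro f hf
  obtain ⟨g, hg⟩ := exists_rpow_mul_norm_fourier_le hβ hf
  refine Asymptotics.IsBigO.of_bound ((2 * K + 2 * 2 ^ β) * ‖g‖) (Eventually.of_forall fun n => ?_)
  have hpos : (0 : ℝ) < 2 ^ (-((n : ℝ) * β)) := by positivity
  rw [norm_norm, Real.norm_of_nonneg hpos.le, norm_sub_proj hv hφ]
  -- Dilating the weighted bound on `𝓕 f` turns `|2ⁿ x| ^ β` into `2 ^ (n * β) * |x| ^ β`; this is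
  -- the source of the rate.
  have hw : ∀ᵐ x : ℝ, |x| ^ β * ‖dilation n (𝓕 f) x‖ ≤
      ‖(((2 ^ (-((n : ℝ) * β)) : ℝ) : ℂ) • dilation n g) x‖ := by
    filter_upwards [coeFn_dilation n (𝓕 f), coeFn_dilation n g,
      Lp.coeFn_smul (((2 ^ (-((n : ℝ) * β)) : ℝ) : ℂ)) (dilation n g),
      (quasiMeasurePreserving_affine (two_zpow_pos n) 0).ae hg] with x h1 h2 h3 h4
    rw [h3, Pi.smul_apply, h1, h2, norm_smul, norm_mul, norm_mul]
    simp only [Complex.norm_real, add_zero] at h4 ⊢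
    rw [Real.norm_of_nonneg hpos.le]
    have e : |x| ^ β = 2 ^ (-((n : ℝ) * β)) * |2 ^ n * x| ^ β := by
      rw [abs_mul, abs_of_pos (two_zpow_pos n), Real.mul_rpow (by positivity) (abs_nonneg x),
        ← Real.rpow_intCast, ← Real.rpow_mul zero_le_two, ← mul_assoc, ← Real.rpow_add two_pos,
        neg_add_cancel, Real.rpow_zero, one_mul]
    rw [e]
    have h5 := mul_le_mul_of_nonneg_left h4 (by positivity :
      0 ≤ (2 : ℝ) ^ (-((n : ℝ) * β)) * ‖(2 : ℝ) ^ ((n : ℝ) / 2)‖)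
    linarith
  refine (norm_sub_apply_adjoint_le hv hβ hK hvK hw).trans_eq ?_
  rw [norm_smul, (dilation n).norm_map, Complex.norm_real, Real.norm_of_nonneg hpos.le]
  ring

/-! ### The pseudo-spline multiplier satisfies the hypotheses. -/

section

variable {α : ℝ} {ℓ : ℕ}

lemma isPeriodicMultiplier_symbol (hα : 1 ≤ α) (hℓ : (ℓ : ℝ) ≤ α - 1 / 2) :
    IsPeriodicMultiplier (symbol α ℓ) :=
  ⟨measurable_symbol hα, sum_symbol_sq_le_one hα hℓ⟩

/-- The term `k = 0` has order `2 * (ℓ + 1)`, the others together order `2 * α`. As `|x| ≤ 1`, both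
exponents may be lowered to `β`, and `A² + B² ≤ (A + B)²`. -/
lemma exists_sum_unitIndicator_sub_symbol_sq_le (hα : 1 ≤ α) (hℓ : (ℓ : ℝ) ≤ α - 1 / 2) {β : ℝ}
    (hβ : 0 ≤ β) (h1 : β ≤ 2 * α) (h2 : β ≤ 2 * ((ℓ : ℝ) + 1)) :
    ∃ K, 0 ≤ K ∧ ∀ x ∈ Set.Ioc (-1 / 2 : ℝ) (1 / 2), ∀ s : Finset ℤ,
      ∑ k ∈ s, (unitIndicator (x + k) - symbol α ℓ (x + k)) ^ 2 ≤ (K * |x| ^ β) ^ 2 := by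
  obtain ⟨A, hA, hA'⟩ := exists_one_sub_symbol_le (ℓ := ℓ) hα
  obtain ⟨B, hB, hB'⟩ := exists_sum_symbol_sq_le hα hℓ
  refine ⟨A + B, by positivity, fun x hx s => ?_⟩
  have hx1 : |x| ≤ 1 := by
    rw [abs_le]
    constructor <;> linarith [hx.1, hx.2]
  have a1 : |x| ^ (2 * α) ≤ |x| ^ β :=
    Real.rpow_le_rpow_of_exponent_ge' (abs_nonneg x) hx1 hβ h1
  have a2 : |x| ^ (2 * (ℓ + 1)) ≤ |x| ^ β := by
    rw [← Real.rpow_natCast]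
    exact Real.rpow_le_rpow_of_exponent_ge' (abs_nonneg x) hx1 hβ (by push_cast; exact h2)
  have a3 : (1 - symbol α ℓ x) ^ 2 ≤ (A * |x| ^ β) ^ 2 :=
    pow_le_pow_left₀ (sub_nonneg.2 (symbol_le_one hα x))
      ((hA' x).trans (mul_le_mul_of_nonneg_left a2 hA)) 2
  have a4 : ∑ k ∈ s.erase 0, (unitIndicator (x + k) - symbol α ℓ (x + k)) ^ 2 ≤
      (B * |x| ^ β) ^ 2 := by
    refine le_trans (le_of_eq (Finset.sum_congr rfl fun k hk => ?_))
      ((hB' x (s.erase 0) (Finset.notMem_erase 0 s)).trans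
        (pow_le_pow_left₀ (by positivity) (mul_le_mul_of_nonneg_left a1 hB) 2))
    rw [unitIndicator_add_int hx (Finset.ne_of_mem_erase hk), zero_sub, neg_sq]
  have a5 : ∑ k ∈ s, (unitIndicator (x + k) - symbol α ℓ (x + k)) ^ 2 ≤
      (1 - symbol α ℓ x) ^ 2 +
        ∑ k ∈ s.erase 0, (unitIndicator (x + k) - symbol α ℓ (x + k)) ^ 2 := by
    refine (Finset.sum_le_sum_of_subset_of_nonneg (Finset.subset_insert 0 s)
      fun _ _ _ => sq_nonneg _).trans_eq ?_
    rw [← Finset.add_sum_erase _ _ (Finset.mem_insert_self 0 s), Finset.erase_insert_eq_erase,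
      Int.cast_zero, add_zero, unitIndicator_of_mem hx]
  have a6 : 0 ≤ A * |x| ^ β * (B * |x| ^ β) := by positivity
  nlinarith

lemma isPseudoSpline_iff (hα : 1 ≤ α) (φ : L2) : IsPseudoSpline α ℓ φ ↔
    (𝓕 φ : L2) =ᵐ[volume] fun x => (symbol α ℓ x : ℂ) := by
  have h (γ : ℝ) := (Complex.continuous_ofReal.tendsto _).comp (tendsto_cascade (ℓ := ℓ) hα γ)
  refine eventually_congr (Eventually.of_forall fun γ => ?_)
  exact ⟨fun h1 => tendsto_nhds_unique h1 (h γ), fun h1 => h1 ▸ h γ⟩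

lemma existsUnique_isPseudoSpline (hα : 1 ≤ α) (hℓ : (ℓ : ℝ) ≤ α - 1 / 2) :
    ∃! φ : L2, IsPseudoSpline α ℓ φ := by
  have hv := isPeriodicMultiplier_symbol hα hℓ
  -- `fourierLp 2 0` is the constant `1`, so its image under `M` is `symbol` as an element of
  -- `L²(ℝ)`.
  refine ⟨𝓕⁻ (hv.toCLM (fourierLp 2 0)), ?_, fun ψ hψ => ?_⟩
  · beta_reduce
    rw [isPseudoSpline_iff hα, FourierTransform.fourier_fourierInv_eq]
    filter_upwards [hv.coeFn_toCLM (fourierLp 2 0),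
      quasiMeasurePreserving_coe_addCircle.ae (coeFn_fourierLp 2 0)] with x h1 h2
    rw [h1, h2, fourier_zero, mul_one]
  · replace hψ := (isPseudoSpline_iff hα ψ).1 hψ
    refine (Lp.fourierTransformₗᵢ ℝ ℂ).eq_symm_apply.2 ?_
    change 𝓕 ψ = _
    refine Lp.ext ?_
    filter_upwards [hψ, hv.coeFn_toCLM (fourierLp 2 0),
      quasiMeasurePreserving_coe_addCircle.ae (coeFn_fourierLp 2 0)] with x h0 h1 h2
    rw [h0, h1, h2, fourier_zero, mul_one]

end

end PseudoSpline

end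

theorem mainTheorem6 (α : ℝ) (hα : 1 ≤ α) (ℓ : ℕ) (hℓ : (ℓ : ℤ) ≤ ⌊α - 1 / 2⌋) :
    (∃! φ : PseudoSpline.L2, PseudoSpline.IsPseudoSpline α ℓ φ) ∧
    ∀ φ : PseudoSpline.L2, PseudoSpline.IsPseudoSpline α ℓ φ →
      (∀ (n : ℤ) (f : PseudoSpline.L2), Summable (PseudoSpline.projTerm φ n f)) ∧
      PseudoSpline.ProvidesApproximationOrder (PseudoSpline.proj φ)
        (min (2 * α) (2 * ((ℓ : ℝ) + 1))) := by
  have hℓ' : (ℓ : ℝ) ≤ α - 1 / 2 := by exact_mod_cast Int.le_floor.1 hℓ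
  refine ⟨PseudoSpline.existsUnique_isPseudoSpline hα hℓ', fun φ hφ => ?_⟩
  rw [PseudoSpline.isPseudoSpline_iff hα] at hφ
  have hv := PseudoSpline.isPeriodicMultiplier_symbol hα hℓ'
  have hβ : 0 ≤ min (2 * α) (2 * ((ℓ : ℝ) + 1)) := le_min (by linarith) (by positivity)
  obtain ⟨K, hK, hvK⟩ := PseudoSpline.exists_sum_unitIndicator_sub_symbol_sq_le hα hℓ' hβ
    (min_le_left _ _) (min_le_right _ _)
  exact ⟨fun n f => (PseudoSpline.hasSum_projTerm hv hφ n f).summable,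
    PseudoSpline.providesApproximationOrder_proj hv hφ hβ hK hvK⟩
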